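/- Let $\mathbb T^3=(\mathbb R/2\pi\mathbb Z)^3\cong(-\pi,\pi]^3$ with Lebesgue measure, let $m>0$ and let $\hat v:\mathbb Z^3\to\mathbb R$ be an even function with $\lim_{|s|\to\infty}|s|^{3+\kappa}\hat v(s)=0$ for some $\kappa>1/2$. Put $v(q)=(2\pi)^{-3/2}\sum_{s\in\mathbb Z^3}\hat v(s)e^{i(q,s)}$, $\varepsilon(q)=\sum_{j=1}^3(1-\cos q^{(j)})$ and, for $k\in(-\pi,\pi]^3$, $$E_k(q)=\tfrac1m\,\varepsilon(\tfrac k2+q)+\tfrac1m\,\varepsilon(\tfrac k2-q),\qquad E_{\min}(k)=\min_{q\in\mathbb T^3}E_k(q).$$ On $L^2(\mathbb T^3)$ let $(Vf)(q)=(2\pi)^{-3/2}\int_{\mathbb T^3}v(q-s)f(s)\,ds$ and $$(H(k)f)(q)=E_k(q)f(q)-(Vf)(q)$$ (the two-particle discrete Schrödinger operator with equal masses $m_1=m_2=m$). Assume that $V$ is positive, i.e. $(Vf,f)\ge 0$ for all $f$. Let $v^{1/2}(p)=(2\pi)^{-3/2}\sum_{s}\hat v(s)^{1/2}e^{i(p,s)}$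 (the series converging in $L^2(\mathbb T^3)$), and let $G(0,0)$ be the integral operator on $L^2(\mathbb T^3)$ with kernel $$G(0,0;p,q)=(2\pi)^{-3}\int_{\mathbb T^3}v^{1/2}(p-t)\,E_0(t)^{-1}\,v^{1/2}(t-q)\,dt .$$ **Theorem.** Assume that $H(0)$ is positive, i.e. $(H(0)f,f)\ge0$ for all $f$, that $\dim\ker H(0)=n$ (zero is an eigenvalue of multiplicity $n$; $n=0$, meaning that zero is not an eigenvalue, is allowed), and that $H(0)$ has a zero-energy resonance, i.e. there is $\psi\in L^2(\mathbb T^3)$ with $G(0,0)\psi=\psi$ and $\int_{\mathbb T^3}v^{1/2}(p)\psi(p)\,dp\ne0$. Then for every nonzero $k\in(-\pi,\pi)^3$ the operator $H(k)$ has at least $n+1$ nonnegative eigenvalues, counted with multiplicity, lying strictly below $E_{\min}(k)$; that is, there are orthonormal $f_0,\dots,f_n\in L^2(\mathbb T^3)$ and real numbers $0\le\mu_i<E_{\min}(k)$ with $H(k)f_i=\mu_if_i$ for $0\le i\le n$. -/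

import Mathlib

open MeasureTheory Filter Topology

namespace LatticeSchrodinger

noncomputable section

instance factTwoPiPos : Fact (0 < 2 * Real.pi) := ⟨Real.two_pi_pos⟩

/-- The torus `𝕋³ = (ℝ / 2πℤ)³`, i.e. `(-π, π]³` with addition modulo `2π`. Its `volume` is the
Lebesgue measure, of total mass `(2π)³`. -/
abbrev T3 : Type := Fin 3 → AddCircle (2 * Real.pi)

/-- The Hilbert space `L²(𝕋³)` of complex-valued square-integrable functions. -/
abbrev L2 : Type := Lp ℂ 2 (volume : Measure T3)

/-- The character `q ↦ exp (i (q, s))`, `(q, s) = ∑ⱼ q⁽ʲ⁾ s⁽ʲ⁾`. -/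
def character (s : Fin 3 → ℤ) : C(T3, ℂ) where
  toFun q := ∏ j, fourier (s j) (q j)
  continuous_toFun := by fun_prop

theorem character_coe (s : Fin 3 → ℤ) (x : Fin 3 → ℝ) :
    character s (fun j => (x j : AddCircle (2 * Real.pi))) =
      Complex.exp (Complex.I * ∑ j, (x j : ℂ) * (s j : ℂ)) := by
  have hpi : (Real.pi : ℂ) ≠ 0 := by exact_mod_cast Real.pi_ne_zero
  simp only [character, ContinuousMap.coe_mk, fourier_coe_apply, Finset.mul_sum, Complex.exp_sum]
  refine Finset.prod_congr rfl fun j _ => ?_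
  congr 1
  push_cast
  field_simp

/-- The one-particle dispersion `ε(q) = ∑ⱼ (1 - cos q⁽ʲ⁾)`. -/
def dispersion (q : T3) : ℝ := ∑ j, (1 - Real.Angle.cos (q j))

/-- The point of the torus with real coordinates `k⁽ʲ⁾ / 2`. -/
def halfPoint (k : Fin 3 → ℝ) : T3 := fun j => ((k j / 2 : ℝ) : AddCircle (2 * Real.pi))

/-- `E_k(q) = (1/m₁) ε(k/2 + q) + (1/m₂) ε(k/2 - q)`. -/
def energy (m₁ m₂ : ℝ) (k : Fin 3 → ℝ) (q : T3) : ℝ :=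
  1 / m₁ * dispersion (halfPoint k + q) + 1 / m₂ * dispersion (halfPoint k - q)

theorem continuous_dispersion : Continuous dispersion :=
  continuous_finsetSum _ fun j _ =>
    continuous_const.sub (Real.Angle.continuous_cos.comp (continuous_apply j))

theorem continuous_energy (m₁ m₂ : ℝ) (k : Fin 3 → ℝ) : Continuous (energy m₁ m₂ k) := by
  have h := continuous_dispersion
  unfold energy
  fun_prop

/-- `E_min(k) = min_q E_k(q)`, the bottom of the band (the infimum is attained, see below). -/
def energyMin (m₁ m₂ : ℝ) (k : Fin 3 → ℝ) : ℝ := ⨅ q : T3, energy m₁ m₂ k q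

theorem energyMin_isLeast (m₁ m₂ : ℝ) (k : Fin 3 → ℝ) :
    IsLeast (Set.range (energy m₁ m₂ k)) (energyMin m₁ m₂ k) :=
  (isCompact_range (continuous_energy m₁ m₂ k)).isLeast_sInf (Set.range_nonempty _)

/-- Multiplication by a continuous function, as a bounded operator on `L²(𝕋³)`. -/
def mulOp (g : C(T3, ℂ)) : L2 →L[ℂ] L2 :=
  (ContinuousLinearMap.mul ℂ ℂ).holderL volume ⊤ 2 2 (ContinuousMap.toLp ⊤ volume ℂ g)

theorem mulOp_coeFn (g : C(T3, ℂ)) (f : L2) : mulOp g f =ᵐ[volume] fun q => g q * f q := by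
  have h1 := (ContinuousLinearMap.mul ℂ ℂ).coeFn_holder (r := 2)
    (ContinuousMap.toLp ⊤ (volume : Measure T3) ℂ g) f
  have h2 := ContinuousMap.coeFn_toLp (p := ⊤) (𝕜 := ℂ) (volume : Measure T3) g
  filter_upwards [h1, h2] with q h1 h2
  rw [← h2]
  exact h1

/-- The free operator `H₀(k)`: multiplication by `E_k`. -/
def freeOp (m₁ m₂ : ℝ) (k : Fin 3 → ℝ) : L2 →L[ℂ] L2 :=
  mulOp ⟨fun q => (energy m₁ m₂ k q : ℂ),
    Complex.continuous_ofReal.comp (continuous_energy m₁ m₂ k)⟩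

theorem freeOp_coeFn (m₁ m₂ : ℝ) (k : Fin 3 → ℝ) (f : L2) :
    freeOp m₁ m₂ k f =ᵐ[volume] fun q => (energy m₁ m₂ k q : ℂ) * f q :=
  mulOp_coeFn _ f

/-- The constant `(2π)^(-3/2)`. -/
def fourierConst : ℝ := (2 * Real.pi) ^ (-(3 / 2) : ℝ)

theorem integrable_coeFn (f : L2) : Integrable (f : T3 → ℂ) volume :=
  (Lp.memLp f).integrable (by norm_num)

theorem integrable_kernel_mul (g : C(T3, ℂ)) (f : L2) (q : T3) :
    Integrable (fun s => g (q - s) * f s) volume :=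
  (integrable_coeFn f).bdd_mul (c := ‖g‖)
    (by fun_prop : Continuous fun s => g (q - s)).aestronglyMeasurable
    (.of_forall fun s => g.norm_coe_le_norm _)

/-- `q ↦ (2π)^(-3/2) ∫ g(q - s) f(s) ds` as a continuous function, for continuous `g`. -/
def convFun (g : C(T3, ℂ)) (f : L2) : C(T3, ℂ) where
  toFun q := (fourierConst : ℂ) * ∫ s, g (q - s) * f s
  continuous_toFun := by
    refine continuous_const.mul (continuous_of_dominated (bound := fun s => ‖g‖ * ‖f s‖)
      (fun q => (integrable_kernel_mul g f q).aestronglyMeasurable) ?_ ?_ ?_)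
    · refine fun q => .of_forall fun s => ?_
      rw [norm_mul]
      gcongr
      exact g.norm_coe_le_norm _
    · exact (integrable_coeFn f).norm.const_mul _
    · exact .of_forall fun s => by fun_prop

theorem exists_convFun_bound (g : C(T3, ℂ)) : ∃ C, ∀ f : L2, ‖convFun g f‖ ≤ C * ‖f‖ := by
  let M : ENNReal := (volume : Measure T3) Set.univ ^ (1 / 2 : ℝ)
  have hM : M ≠ ⊤ := ENNReal.rpow_ne_top_of_nonneg (by norm_num) (measure_ne_top _ _)
  have key : ∀ f : L2, ∫ s, ‖f s‖ ≤ ‖f‖ * M.toReal := fun f => by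
    have h := eLpNorm_le_eLpNorm_mul_rpow_measure_univ (μ := (volume : Measure T3))
      (p := 1) (q := 2) (by norm_num) (Lp.aestronglyMeasurable f)
    have he : (1 / (1 : ENNReal).toReal - 1 / (2 : ENNReal).toReal) = (1 / 2 : ℝ) := by norm_num
    rw [he] at h
    rw [integral_norm_eq_lintegral_enorm (Lp.aestronglyMeasurable f),
      ← eLpNorm_one_eq_lintegral_enorm, Lp.norm_def, ← ENNReal.toReal_mul]
    exact ENNReal.toReal_mono (ENNReal.mul_ne_top (Lp.eLpNorm_ne_top f) hM) h
  refine ⟨‖(fourierConst : ℂ)‖ * (‖g‖ * M.toReal), fun f => ?_⟩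
  refine (ContinuousMap.norm_le _ (by positivity)).2 fun q => ?_
  change ‖(fourierConst : ℂ) * ∫ s, g (q - s) * f s‖ ≤ _
  rw [norm_mul, mul_assoc]
  refine mul_le_mul_of_nonneg_left ?_ (norm_nonneg _)
  calc ‖∫ s, g (q - s) * f s‖ ≤ ∫ s, ‖g‖ * ‖f s‖ := by
        refine norm_integral_le_of_norm_le ((integrable_coeFn f).norm.const_mul _)
          (.of_forall fun s => ?_)
        rw [norm_mul]
        gcongr
        exact g.norm_coe_le_norm _
    _ = ‖g‖ * ∫ s, ‖f s‖ := integral_const_mul _ _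
    _ ≤ ‖g‖ * (‖f‖ * M.toReal) := by gcongr; exact key f
    _ = ‖g‖ * M.toReal * ‖f‖ := by ring

/-- `convFun g` as a linear map. -/
def convLin (g : C(T3, ℂ)) : L2 →ₗ[ℂ] C(T3, ℂ) where
  toFun := convFun g
  map_add' f₁ f₂ := by
    ext q
    simp only [convFun, ContinuousMap.coe_mk, ContinuousMap.add_apply]
    rw [← mul_add, ← integral_add (integrable_kernel_mul g f₁ q) (integrable_kernel_mul g f₂ q)]
    congr 1
    refine integral_congr_ae ?_
    filter_upwards [Lp.coeFn_add f₁ f₂] with s hs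
    rw [hs, Pi.add_apply, mul_add]
  map_smul' c f := by
    ext q
    simp only [convFun, ContinuousMap.coe_mk, ContinuousMap.smul_apply, RingHom.id_apply,
      smul_eq_mul]
    rw [mul_left_comm, ← integral_const_mul c (fun s => g (q - s) * f s)]
    congr 1
    refine integral_congr_ae ?_
    filter_upwards [Lp.coeFn_smul c f] with s hs
    rw [hs, Pi.smul_apply, smul_eq_mul, mul_left_comm]

/-- Convolution `f ↦ (2π)^(-3/2) ∫ g(· - s) f(s) ds` as a bounded operator on `L²(𝕋³)`. -/
def convOp (g : C(T3, ℂ)) : L2 →L[ℂ] L2 :=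
  (ContinuousMap.toLp 2 (volume : Measure T3) ℂ).comp
    ((convLin g).mkContinuousOfExistsBound (exists_convFun_bound g))

theorem convOp_coeFn (g : C(T3, ℂ)) (f : L2) :
    convOp g f =ᵐ[volume] fun q => (fourierConst : ℂ) * ∫ s, g (q - s) * f s :=
  ContinuousMap.coeFn_toLp (p := 2) (𝕜 := ℂ) (volume : Measure T3) (convFun g f)

/-- `v(q) = (2π)^(-3/2) ∑ₛ v̂(s) exp (i (q, s))`, a uniformly convergent series for summable `v̂`. -/
def potentialKernel (vhat : (Fin 3 → ℤ) → ℝ) : C(T3, ℂ) :=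
  (fourierConst : ℂ) • ∑' s, (vhat s : ℂ) • character s

/-- The interaction operator `(V f)(q) = (2π)^(-3/2) ∫ v(q - s) f(s) ds`. -/
def interaction (vhat : (Fin 3 → ℤ) → ℝ) : L2 →L[ℂ] L2 := convOp (potentialKernel vhat)

/-- The two-particle discrete Schrödinger operator `H(k) = H₀(k) - V`. -/
def hamiltonian (m₁ m₂ : ℝ) (vhat : (Fin 3 → ℤ) → ℝ) (k : Fin 3 → ℝ) : L2 →L[ℂ] L2 :=
  freeOp m₁ m₂ k - interaction vhat

/-- `v^(1/2)(p) = (2π)^(-3/2) ∑ₛ v̂(s)^(1/2) exp (i (p, s))`. Only `∑ₛ v̂(s) < ∞` is available, so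
the Fourier series converges in `L²(𝕋³)`. -/
def sqrtKernel (vhat : (Fin 3 → ℤ) → ℝ) : L2 :=
  (fourierConst : ℂ) •
    ∑' s, ((Real.sqrt (vhat s) : ℝ) : ℂ) • ContinuousMap.toLp 2 (volume : Measure T3) ℂ (character s)

/-- The kernel
`G(k, z; p, q) = (2π)⁻³ ∫ v^(1/2)(p - t) (E_k(t) - z)⁻¹ v^(1/2)(t - q) dt`. -/
def birmanSchwingerKernel (m₁ m₂ : ℝ) (vhat : (Fin 3 → ℤ) → ℝ) (k : Fin 3 → ℝ) (z : ℝ)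
    (p q : T3) : ℂ :=
  (((2 * Real.pi) ^ 3)⁻¹ : ℝ) *
    ∫ t, sqrtKernel vhat (p - t) * ((energy m₁ m₂ k t - z)⁻¹ : ℝ) * sqrtKernel vhat (t - q)

/-- `H(0)` has a zero-energy resonance: the integral operator `G(0, 0)` has eigenvalue `1` with an
eigenfunction `ψ` such that `(v^(1/2), ψ) = ∫ v^(1/2)(p) ψ(p) dp ≠ 0` (so that `ψ ≠ 0`). -/
def HasZeroEnergyResonance (m₁ m₂ : ℝ) (vhat : (Fin 3 → ℤ) → ℝ) : Prop :=
  ∃ ψ : L2, (∀ᵐ p, ∫ q, birmanSchwingerKernel m₁ m₂ vhat 0 0 p q * ψ q = ψ p) ∧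
    ∫ p, sqrtKernel vhat p * ψ p ≠ 0

end

end LatticeSchrodinger

open LatticeSchrodinger

/-! ### Negative eigenvalues of a positive operator minus a compact one -/

section Spectral

open scoped InnerProductSpace

/-! For equal masses `E_k - E_min(k) = E_0 - D`, where the gap `D` (`energyGap`) satisfies `0 ≤ D ≤
E_0` and is positive almost everywhere when `k ≠ 0`. The form of `H(k) - E_min(k)` is therefore that
of `H(0)` minus `∫ D |f|²` (`re_inner_shifted`), and it is negative definite on `ker H(0)`. This
accounts for `n` dimensions.

The resonance supplies one more. Put `w = v^(1/2)` and `f = E_0⁻¹ (w * ψ)`. Then `f` is integrable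
because `1/E_0` is integrable in dimension three, and Fubini's theorem turns `G(0,0) ψ = ψ` into
`E_0 f = v * f`, up to normalization. Since `(w * ψ)(0) ≠ 0` and `1/E_0²` is not integrable at the
origin, `f` is not in `L²`; but `√D f` is. The regularizations `u_δ = (E_0 + δ)⁻¹ (w * ψ)` lie in
`L²`, an upper bound for their `H(0)`-energy tends to `0`, and `√D u_δ → √D f` in `L²`. The limit
has positive distance from the finite-dimensional space `√D ker H(0)`, so for small `δ` the
subtracted term wins on all of `ker H(0) + ℂ u_δ` (`form_neg_of_trial`, `exists_trial`).

As `V` is compact, a space of dimension `n + 1` with negative form yields `n + 1` orthonormal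
eigenvectors below `E_min(k)` (`exists_orthonormal_eigenvectors_neg`). Their eigenvalues are
nonnegative because `E_k` is the average of two translates of `E_0` and `V` commutes with
translations, so `H(0) ≥ 0` forces `H(k) ≥ 0` (`re_inner_hamiltonian_nonneg`). -/

theorem norm_sq_le_of_isPositive {E : Type*} [NormedAddCommGroup E] [InnerProductSpace ℂ E]
    {B : E →L[ℂ] E} (hB : B.IsPositive) (x : E) :
    ‖B x‖ ^ 2 ≤ (‖B‖ + 1) * (⟪B x, x⟫_ℂ).re := by
  -- Positivity at `x - t B x` reads `2t‖Bx‖² ≤ (Bx, x) + t²(BBx, Bx)`, and this `t` makes the last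
  -- term at most `t‖Bx‖²`. The `+ 1` keeps `t` meaningful for `B = 0`.
  set t : ℝ := (‖B‖ + 1)⁻¹ with ht
  have hpos : 0 < ‖B‖ + 1 := by positivity
  have h := hB.re_inner_nonneg_left (x - (t : ℂ) • B x)
  have hs : ⟪B (B x), x⟫_ℂ = ⟪B x, B x⟫_ℂ := hB.isSymmetric _ _
  have hb : (⟪B (B x), B x⟫_ℂ).re ≤ ‖B‖ * ‖B x‖ ^ 2 := by
    calc (⟪B (B x), B x⟫_ℂ).re ≤ ‖B (B x)‖ * ‖B x‖ := re_inner_le_norm (𝕜 := ℂ) _ _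
      _ ≤ (‖B‖ * ‖B x‖) * ‖B x‖ := by gcongr; exact B.le_opNorm _
      _ = _ := by ring
  have hn : (⟪B x, B x⟫_ℂ).re = ‖B x‖ ^ 2 := by
    rw [inner_self_eq_norm_sq_to_K]; norm_cast
  simp only [map_sub, map_smul, inner_sub_left, inner_sub_right, inner_smul_left, inner_smul_right,
    hs, Complex.conj_ofReal, RCLike.re_to_complex, Complex.sub_re, Complex.re_ofReal_mul, hn] at h
  have ht1 : t * (‖B‖ + 1) = 1 := inv_mul_cancel₀ hpos.ne'
  have ht0 : 0 < t := inv_pos.2 hpos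
  have h2 : t * (t * (⟪B (B x), B x⟫_ℂ).re) ≤ t * (t * (‖B‖ * ‖B x‖ ^ 2)) := by gcongr
  have h3 : t * ‖B x‖ ^ 2 ≤ (⟪B x, x⟫_ℂ).re := by
    have : t * (t * (‖B‖ * ‖B x‖ ^ 2)) = t * ‖B x‖ ^ 2 - t * t * ‖B x‖ ^ 2 := by
      have : t * ‖B‖ = 1 - t := by linarith
      calc _ = t * (t * ‖B‖) * ‖B x‖ ^ 2 := by ring
        _ = _ := by rw [this]; ring
    nlinarith [mul_nonneg (mul_nonneg ht0.le ht0.le) (sq_nonneg ‖B x‖)]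
  calc ‖B x‖ ^ 2 = (‖B‖ + 1) * (t * ‖B x‖ ^ 2) := by rw [← mul_assoc, mul_comm _ t, ht1, one_mul]
    _ ≤ _ := by gcongr

/-- If a positive operator minus a compact symmetric operator has a negative expectation value, the
bottom of its numerical range is attained at an eigenvector. -/
theorem exists_unit_eigenvector_neg {E : Type*} [NormedAddCommGroup E] [InnerProductSpace ℂ E]
    [CompleteSpace E] {M V : E →L[ℂ] E} (hM : M.IsPositive)
    (hV : (V : E →ₗ[ℂ] E).IsSymmetric) (hVc : IsCompactOperator V) {x₀ : E}
    (hx₀ : (⟪(M - V) x₀, x₀⟫_ℂ).re < 0) :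
    ∃ l : ℝ, l < 0 ∧ ∃ e : E, ‖e‖ = 1 ∧ (M - V) e = (l : ℂ) • e := by
  set A := M - V with hA
  set S : Set ℝ := (fun x => (⟪A x, x⟫_ℂ).re) '' Metric.sphere (0 : E) 1 with hS
  have hne : x₀ ≠ 0 := by rintro rfl; simp at hx₀
  have hbdd : BddBelow S := by
    refine ⟨-‖A‖, ?_⟩
    rintro _ ⟨x, hx, rfl⟩
    have hx1 : ‖x‖ = 1 := by simpa using hx
    have h1 : ‖⟪A x, x⟫_ℂ‖ ≤ ‖A‖ := by
      calc _ ≤ ‖A x‖ * ‖x‖ := norm_inner_le_norm _ _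
        _ ≤ ‖A‖ * ‖x‖ * ‖x‖ := by gcongr; exact A.le_opNorm _
        _ = ‖A‖ := by rw [hx1]; ring
    have h2 := Complex.abs_re_le_norm (⟪A x, x⟫_ℂ)
    exact (abs_le.1 (h2.trans h1)).1
  have hquad : ∀ x : E, x ≠ 0 → ∃ s ∈ S, (⟪A x, x⟫_ℂ).re = s * ‖x‖ ^ 2 := by
    intro x hx
    have hx' : ‖x‖ ≠ 0 := norm_ne_zero_iff.2 hx
    refine ⟨_, ⟨((‖x‖⁻¹ : ℝ) : ℂ) • x, ?_, rfl⟩, ?_⟩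
    · simp [norm_smul, hx']
    · simp only [map_smul, inner_smul_left, inner_smul_right, Complex.conj_ofReal,
        Complex.re_ofReal_mul]
      field_simp
  set l := sInf S with hl
  have hneg : l < 0 := by
    obtain ⟨s, hs, hs2⟩ := hquad x₀ hne
    refine (csInf_le hbdd hs).trans_lt ?_
    by_contra hcon
    push Not at hcon
    rw [hs2] at hx₀
    exact absurd hx₀ (not_lt.2 (by positivity))
  have hSne : S.Nonempty := by
    obtain ⟨s, hs, -⟩ := hquad x₀ hne
    exact ⟨s, hs⟩
  set B : E →L[ℂ] E := A - (l : ℂ) • ContinuousLinearMap.id ℂ E with hB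
  have hBre : ∀ x, (⟪B x, x⟫_ℂ).re = (⟪A x, x⟫_ℂ).re - l * ‖x‖ ^ 2 := by
    intro x
    simp only [hB, sub_apply, smul_apply,
      ContinuousLinearMap.id_apply, inner_sub_left, inner_smul_left, Complex.conj_ofReal,
      Complex.sub_re, Complex.re_ofReal_mul, inner_self_eq_norm_sq_to_K]
    norm_cast
  have hBpos : B.IsPositive := by
    refine ⟨fun x y => ?_, fun x => ?_⟩
    · have h1 := hM.isSymmetric x y
      have h2 := hV x y
      simp only [ContinuousLinearMap.coe_coe] at h1 h2
      simp only [ContinuousLinearMap.coe_coe, hB, hA, sub_apply, smul_apply,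
        ContinuousLinearMap.id_apply, inner_sub_left, inner_sub_right, inner_smul_left,
        inner_smul_right, Complex.conj_ofReal, h1, h2]
    · change 0 ≤ (⟪B x, x⟫_ℂ).re
      rw [hBre]
      by_cases hx : x = 0
      · simp [hx]
      · obtain ⟨s, hs, hs2⟩ := hquad x hx
        rw [hs2, ← sub_mul]
        exact mul_nonneg (sub_nonneg.2 (csInf_le hbdd hs)) (by positivity)
  -- A minimizing sequence of unit vectors: the form of the positive operator `B = A - l` tends to
  -- `0` along it, hence so does `B x n` itself.
  obtain ⟨u, -, hu, huS⟩ := exists_seq_tendsto_sInf hSne hbdd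
  choose x hxs hxu using huS
  have hx1 : ∀ n, ‖x n‖ = 1 := fun n => by simpa using hxs n
  have hBx : Tendsto (fun n => B (x n)) atTop (𝓝 0) := by
    rw [tendsto_zero_iff_norm_tendsto_zero]
    have h1 : Tendsto (fun n => Real.sqrt ((‖B‖ + 1) * (u n - l))) atTop (𝓝 0) := by
      have : Tendsto (fun n => Real.sqrt ((‖B‖ + 1) * (u n - l))) atTop
          (𝓝 (Real.sqrt ((‖B‖ + 1) * (l - l)))) :=
        ((hu.sub_const l).const_mul _).sqrt
      simpa using this
    refine squeeze_zero (fun _ => norm_nonneg _) (fun n => Real.le_sqrt_of_sq_le ?_) h1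
    have h2 := norm_sq_le_of_isPositive hBpos (x n)
    have h3 : (⟪A (x n), x n⟫_ℂ).re = u n := hxu n
    rwa [hBre, h3, hx1, one_pow, mul_one] at h2
  have hK := hVc.isCompact_closure_image_closedBall (f := (V : E →ₗ[ℂ] E)) 1
  obtain ⟨y, -, φ, hφ, hy⟩ := hK.tendsto_subseq (x := fun n => V (x n))
    fun n => subset_closure ⟨x n, by simp [hx1], rfl⟩
  set M' : E →L[ℂ] E := M - (l : ℂ) • ContinuousLinearMap.id ℂ E with hM'
  -- `M' = M - l` is bounded below because `l < 0`. Since `M' x = B x + V x` converges along the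
  -- subsequence, `x (φ n)` is Cauchy in norm, so the limit is still a unit vector.
  have hanti : ∀ z, -l * ‖z‖ ≤ ‖M' z‖ := by
    intro z
    by_cases hz : z = 0
    · simp [hz]
    have hz' : 0 < ‖z‖ := norm_pos_iff.2 hz
    have h1 : -l * ‖z‖ ^ 2 ≤ ‖M' z‖ * ‖z‖ := by
      refine le_trans ?_ (re_inner_le_norm (𝕜 := ℂ) (M' z) z)
      have h2 := hM.re_inner_nonneg_left z
      have h3 : (⟪M' z, z⟫_ℂ).re = (⟪M z, z⟫_ℂ).re - l * ‖z‖ ^ 2 := by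
        simp only [hM', sub_apply, smul_apply,
          ContinuousLinearMap.id_apply, inner_sub_left, inner_smul_left, Complex.conj_ofReal,
          Complex.sub_re, Complex.re_ofReal_mul, inner_self_eq_norm_sq_to_K]
        norm_cast
      change _ ≤ (⟪M' z, z⟫_ℂ).re
      rw [h3]
      change 0 ≤ (⟪M z, z⟫_ℂ).re at h2
      linarith
    have : (-l * ‖z‖) * ‖z‖ ≤ ‖M' z‖ * ‖z‖ := by linarith [h1, sq ‖z‖]
    exact le_of_mul_le_mul_right this hz'
  have hM'x : Tendsto (fun n => M' (x (φ n))) atTop (𝓝 y) := by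
    have h1 := (hBx.comp hφ.tendsto_atTop).add hy
    rw [zero_add] at h1
    refine h1.congr fun n => ?_
    simp only [hB, hA, hM', Function.comp_apply, sub_apply]
    abel
  have hcau : CauchySeq fun n => x (φ n) := by
    rw [Metric.cauchySeq_iff'] 
    intro ε hε
    obtain ⟨N, hN⟩ := Metric.cauchySeq_iff'.1 hM'x.cauchySeq (-l * ε)
      (mul_pos (neg_pos.2 hneg) hε)
    refine ⟨N, fun n hn => ?_⟩
    have h1 := hN n hn
    rw [dist_eq_norm, ← map_sub] at h1
    rw [dist_eq_norm]
    exact lt_of_mul_lt_mul_left ((hanti _).trans_lt h1) (neg_pos.2 hneg).le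
  obtain ⟨e, he⟩ := cauchySeq_tendsto_of_complete hcau
  refine ⟨l, hneg, e, ?_, ?_⟩
  · have := he.norm
    simp only [hx1] at this
    exact (tendsto_nhds_unique this tendsto_const_nhds)
  · have h1 := (B.continuous.tendsto e).comp he
    have h2 := tendsto_nhds_unique h1 (hBx.comp hφ.tendsto_atTop)
    rw [← sub_eq_zero]
    simpa [hB] using h2

/-- The compression of a bounded operator to a subspace. -/
noncomputable def compression {E : Type*} [NormedAddCommGroup E] [InnerProductSpace ℂ E]
    (W : Submodule ℂ E) [W.HasOrthogonalProjection] (L : E →L[ℂ] E) : W →L[ℂ] W :=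
  W.orthogonalProjectionOnto ∘L L ∘L W.subtypeL

theorem inner_compression_left {E : Type*} [NormedAddCommGroup E] [InnerProductSpace ℂ E]
    (W : Submodule ℂ E) [W.HasOrthogonalProjection] (L : E →L[ℂ] E) (x y : W) :
    ⟪compression W L x, y⟫_ℂ = ⟪L x, (y : E)⟫_ℂ :=
  Submodule.inner_orthogonalProjectionOnto_eq_of_mem_right y (L x)

theorem inner_compression_right {E : Type*} [NormedAddCommGroup E] [InnerProductSpace ℂ E]
    (W : Submodule ℂ E) [W.HasOrthogonalProjection] (L : E →L[ℂ] E) (x y : W) :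
    ⟪x, compression W L y⟫_ℂ = ⟪(x : E), L y⟫_ℂ :=
  Submodule.inner_orthogonalProjectionOnto_eq_of_mem_left x (L y)

theorem compression_sub {E : Type*} [NormedAddCommGroup E] [InnerProductSpace ℂ E]
    (W : Submodule ℂ E) [W.HasOrthogonalProjection] (L L' : E →L[ℂ] E) :
    compression W (L - L') = compression W L - compression W L' := by
  ext x
  simp [compression]

theorem coe_compression_of_mem {E : Type*} [NormedAddCommGroup E] [InnerProductSpace ℂ E]
    (W : Submodule ℂ E) [W.HasOrthogonalProjection] (L : E →L[ℂ] E) (x : W) (h : L x ∈ W) :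
    (compression W L x : E) = L x :=
  congrArg Subtype.val (Submodule.orthogonalProjectionOnto_mem_subspace_eq_self (⟨L x, h⟩ : W))

theorem isPositive_compression {E : Type*} [NormedAddCommGroup E] [InnerProductSpace ℂ E]
    (W : Submodule ℂ E) [W.HasOrthogonalProjection] {L : E →L[ℂ] E} (hL : L.IsPositive) :
    (compression W L).IsPositive := by
  refine ⟨fun x y => ?_, fun x => ?_⟩
  · simp only [ContinuousLinearMap.coe_coe, inner_compression_left, inner_compression_right]
    exact hL.isSymmetric _ _
  · change 0 ≤ (⟪compression W L x, x⟫_ℂ).re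
    rw [inner_compression_left]
    exact hL.re_inner_nonneg_left _

theorem isSymmetric_compression {E : Type*} [NormedAddCommGroup E] [InnerProductSpace ℂ E]
    (W : Submodule ℂ E) [W.HasOrthogonalProjection] {L : E →L[ℂ] E}
    (hL : (L : E →ₗ[ℂ] E).IsSymmetric) : (compression W L : W →ₗ[ℂ] W).IsSymmetric := fun x y => by
  simp only [ContinuousLinearMap.coe_coe, inner_compression_left, inner_compression_right]
  exact hL _ _

theorem isCompactOperator_compression {E : Type*} [NormedAddCommGroup E] [InnerProductSpace ℂ E]
    (W : Submodule ℂ E) [W.HasOrthogonalProjection] {L : E →L[ℂ] E} (hL : IsCompactOperator L) :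
    IsCompactOperator (compression W L) :=
  (hL.comp_clm W.subtypeL).clm_comp W.orthogonalProjectionOnto

-- Induction on `N`: split off one eigenvector `e` and compress to its orthogonal complement, which
-- `M - V` leaves invariant by symmetry. The test space is a map `T` out of an abstract `F`, so that
-- the inductive step only restricts `T`; strict negativity already makes `T` injective. The space
-- `E` is quantified inside because it changes at each step.
set_option maxHeartbeats 1000000 in
theorem exists_orthonormal_eigenvectors_neg (N : ℕ) :
    ∀ {E : Type*} [NormedAddCommGroup E] [InnerProductSpace ℂ E] [CompleteSpace E]
    {F : Type*} [AddCommGroup F] [Module ℂ F] [FiniteDimensional ℂ F]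
    {M V : E →L[ℂ] E} (_ : M.IsPositive)
    (_ : (V : E →ₗ[ℂ] E).IsSymmetric) (_ : IsCompactOperator V) (T : F →ₗ[ℂ] E)
    (_ : ∀ x, x ≠ 0 → (⟪(M - V) (T x), T x⟫_ℂ).re < 0) (_ : N ≤ Module.finrank ℂ F),
    ∃ (μ : Fin N → ℝ) (f : Fin N → E), Orthonormal ℂ f ∧
      ∀ i, (M - V) (f i) = (μ i : ℂ) • f i ∧ μ i < 0 := by
  induction N with
  | zero =>
    intros
    exact ⟨Fin.elim0, Fin.elim0, ⟨fun i => i.elim0, fun i => i.elim0⟩, fun i => i.elim0⟩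
  | succ N ih =>
    intro E _ _ _ F _ _ _ M V hM hV hVc T hT hN
    have : Nontrivial F := Module.nontrivial_of_finrank_pos (R := ℂ) (by omega)
    obtain ⟨x₀, hx₀⟩ := exists_ne (0 : F)
    obtain ⟨l, hl, e, he1, he⟩ := exists_unit_eigenvector_neg hM hV hVc (hT x₀ hx₀)
    set W : Submodule ℂ E := (ℂ ∙ e)ᗮ with hW
    have hmem : ∀ x, x ∈ W ↔ ⟪e, x⟫_ℂ = 0 := fun x => Submodule.mem_orthogonal_singleton_iff_inner_right
    have hinv : ∀ x : W, (compression W M - compression W V) x = (M - V) (x : E) := by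
      intro x
      have h1 : (M - V) (x : E) ∈ W := by
        rw [hmem]
        have h2 : ⟪e, (M - V) x⟫_ℂ = ⟪(M - V) e, x⟫_ℂ := by
          have h1 := hM.isSymmetric e x
          have h2 := hV e x
          simp only [ContinuousLinearMap.coe_coe] at h1 h2
          rw [sub_apply, sub_apply, inner_sub_left, inner_sub_right, h1, h2]
        rw [h2, he, inner_smul_left, (hmem _).1 x.2, mul_zero]
      rw [← compression_sub, coe_compression_of_mem _ _ _ h1]
    -- Orthogonality to `e` is one linear condition on `F`, so it costs at most one dimension.
    let φ : F →ₗ[ℂ] ℂ := (innerSL ℂ e).toLinearMap ∘ₗ T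
    let T' : φ.ker →ₗ[ℂ] W := (T ∘ₗ φ.ker.subtype).codRestrict W
      fun x => (hmem _).2 (LinearMap.mem_ker.1 x.2)
    have hfin : N ≤ Module.finrank ℂ φ.ker := by
      have h1 := φ.finrank_range_add_finrank_ker
      have h2 : Module.finrank ℂ φ.range ≤ 1 := by
        simpa using Submodule.finrank_le φ.range
      omega
    obtain ⟨μ, f, hf, hμ⟩ := ih (isPositive_compression W hM) (isSymmetric_compression W hV)
      (isCompactOperator_compression W hVc) T'
      (fun x hx => by
        have h1 : ⟪(compression W M - compression W V) (T' x), T' x⟫_ℂ = ⟪(M - V) (T x), T x⟫_ℂ := by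
          rw [Submodule.coe_inner, hinv]; rfl
        rw [h1]
        exact hT x fun h => hx (Subtype.ext h)) hfin
    refine ⟨Fin.cons l μ, Fin.cons e fun i => (f i : E), ⟨?_, ?_⟩, ?_⟩
    · refine Fin.cases he1 fun i => ?_
      simpa using hf.1 i
    · intro i j hij
      induction i using Fin.cases with
      | zero =>
        induction j using Fin.cases with
        | zero => exact absurd rfl hij
        | succ j => simpa using (hmem _).1 (f j).2
      | succ i =>
        induction j using Fin.cases with
        | zero => simpa using inner_eq_zero_symm.1 ((hmem _).1 (f i).2)
        | succ j =>
          have := hf.2 (show i ≠ j from fun h => hij (by rw [h]))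
          simpa using this
    · refine Fin.cases ⟨he, hl⟩ fun i => ⟨?_, (hμ i).2⟩
      have h1 := congrArg (Subtype.val) (hμ i).1
      rw [hinv] at h1
      simpa using h1

end Spectral

namespace LatticeSchrodinger

noncomputable section

/-! ### The band function and the gap -/

theorem angle_cos_add (a b : AddCircle (2 * Real.pi)) :
    Real.Angle.cos (a + b) =
      Real.Angle.cos a * Real.Angle.cos b - Real.Angle.sin a * Real.Angle.sin b :=
  Real.Angle.cos_add a b

theorem angle_cos_neg (a : AddCircle (2 * Real.pi)) :
    Real.Angle.cos (-a) = Real.Angle.cos a := Real.Angle.cos_neg a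

theorem angle_sin_neg (a : AddCircle (2 * Real.pi)) :
    Real.Angle.sin (-a) = -Real.Angle.sin a := Real.Angle.sin_neg a

theorem angle_cos_sub (a b : AddCircle (2 * Real.pi)) :
    Real.Angle.cos (a - b) =
      Real.Angle.cos a * Real.Angle.cos b + Real.Angle.sin a * Real.Angle.sin b := by
  rw [sub_eq_add_neg, angle_cos_add, angle_cos_neg, angle_sin_neg]
  ring

theorem angle_cos_le_one (a : AddCircle (2 * Real.pi)) : Real.Angle.cos a ≤ 1 := by
  induction a using QuotientAddGroup.induction_on with
  | H x => exact Real.cos_le_one x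

theorem angle_cos_eq_one_iff (a : AddCircle (2 * Real.pi)) : Real.Angle.cos a = 1 ↔ a = 0 := by
  have h := Real.Angle.cos_eq_iff_eq_or_eq_neg (θ := a) (ψ := 0)
  rw [Real.Angle.cos_zero, neg_zero, or_self] at h
  exact h

theorem dispersion_neg (q : T3) : dispersion (-q) = dispersion q := by
  simp only [dispersion, Pi.neg_apply, angle_cos_neg]

/-- With equal masses the sine terms of the two addition formulas cancel. This places the minimum at
`q = 0` for every `k` in the open cube. -/
theorem energy_eq (m : ℝ) (k : Fin 3 → ℝ) (q : T3) :
    energy m m k q = 2 / m * ∑ j, (1 - Real.cos (k j / 2) * Real.Angle.cos (q j)) := by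
  have h : ∀ x : ℝ, Real.Angle.cos (x : AddCircle (2 * Real.pi)) = Real.cos x := fun x => rfl
  simp only [energy, dispersion, ← mul_add, ← Finset.sum_add_distrib, Finset.mul_sum]
  refine Finset.sum_congr rfl fun j _ => ?_
  simp only [Pi.add_apply, Pi.sub_apply, angle_cos_add, angle_cos_sub, halfPoint, h]
  ring

theorem energy_zero_eq (m : ℝ) (q : T3) :
    energy m m 0 q = 2 / m * ∑ j, (1 - Real.Angle.cos (q j)) := by
  simp [energy_eq]

theorem cos_half_pos {k : Fin 3 → ℝ} (hk : ∀ j, k j ∈ Set.Ioo (-Real.pi) Real.pi) (j : Fin 3) :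
    0 < Real.cos (k j / 2) :=
  Real.cos_pos_of_mem_Ioo ⟨by linarith [(hk j).1], by linarith [(hk j).2]⟩

theorem energyMin_eq {m : ℝ} (hm : 0 < m) {k : Fin 3 → ℝ}
    (hk : ∀ j, k j ∈ Set.Ioo (-Real.pi) Real.pi) :
    energyMin m m k = 2 / m * ∑ j, (1 - Real.cos (k j / 2)) := by
  refine (energyMin_isLeast m m k).unique ⟨⟨0, ?_⟩, ?_⟩
  · have : Real.Angle.cos (0 : AddCircle (2 * Real.pi)) = 1 := Real.Angle.cos_zero
    simp [energy_eq, this]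
  · rintro _ ⟨q, rfl⟩
    rw [energy_eq]
    gcongr with j
    exact mul_le_of_le_one_right (cos_half_pos hk j).le (angle_cos_le_one _)

/-- The amount by which raising the quasi-momentum from `0` to `k` lowers the band function measured
from its bottom. -/
def energyGap (m : ℝ) (k : Fin 3 → ℝ) (q : T3) : ℝ :=
  2 / m * ∑ j, (1 - Real.cos (k j / 2)) * (1 - Real.Angle.cos (q j))

/-- In each coordinate, `(1 - cx) - (1 - c) = (1 - x) - (1 - c)(1 - x)` with `c = cos (k j / 2)`, `x
= cos (q j)`. -/
theorem energy_sub_energyMin {m : ℝ} (hm : 0 < m) {k : Fin 3 → ℝ}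
    (hk : ∀ j, k j ∈ Set.Ioo (-Real.pi) Real.pi) (q : T3) :
    energy m m k q - energyMin m m k = energy m m 0 q - energyGap m k q := by
  simp only [energyMin_eq hm hk, energy_eq, energyGap, ← mul_sub, ← Finset.sum_sub_distrib]
  congr 1
  refine Finset.sum_congr rfl fun j _ => ?_
  simp
  ring

theorem continuous_energyGap (m : ℝ) (k : Fin 3 → ℝ) : Continuous (energyGap m k) :=
  continuous_const.mul <| continuous_finsetSum _ fun j _ =>
    continuous_const.mul <| continuous_const.sub
      (Real.Angle.continuous_cos.comp (continuous_apply j))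

theorem energyGap_nonneg {m : ℝ} (hm : 0 < m) (k : Fin 3 → ℝ) (q : T3) : 0 ≤ energyGap m k q :=
  mul_nonneg (by positivity) (Finset.sum_nonneg fun j _ =>
    mul_nonneg (sub_nonneg.2 (Real.cos_le_one _)) (sub_nonneg.2 (angle_cos_le_one _)))

theorem energyGap_le {m : ℝ} (hm : 0 < m) {k : Fin 3 → ℝ}
    (hk : ∀ j, k j ∈ Set.Ioo (-Real.pi) Real.pi) (q : T3) :
    energyGap m k q ≤ energy m m 0 q := by
  rw [energy_zero_eq, energyGap]
  gcongr with j
  exact mul_le_of_le_one_left (sub_nonneg.2 (angle_cos_le_one _))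
    (by linarith [cos_half_pos hk j])

instance : NullSingletonClass (volume : Measure (AddCircle (2 * Real.pi))) where
  measure_singleton x := by
    rw [← Metric.closedBall_zero, AddCircle.volume_closedBall, mul_zero,
      min_eq_right Real.two_pi_pos.le, ENNReal.ofReal_zero]

theorem ae_ne_zero (j : Fin 3) : ∀ᵐ q : T3, q j ≠ 0 :=
  compl_mem_ae_iff.2 (Measure.pi_hyperplane _ j 0)

/-- A nonzero coordinate `k j` makes its summand positive off the null hyperplane `q j = 0`. -/
theorem ae_energyGap_pos {m : ℝ} (hm : 0 < m) {k : Fin 3 → ℝ}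
    (hk : ∀ j, k j ∈ Set.Ioo (-Real.pi) Real.pi) (hk0 : k ≠ 0) :
    ∀ᵐ q : T3, 0 < energyGap m k q := by
  obtain ⟨j, hj⟩ := Function.ne_iff.1 hk0
  filter_upwards [ae_ne_zero j] with q hq
  refine mul_pos (by positivity) (Finset.sum_pos' (fun i _ =>
    mul_nonneg (sub_nonneg.2 (Real.cos_le_one _)) (sub_nonneg.2 (angle_cos_le_one _)))
    ⟨j, Finset.mem_univ j, mul_pos ?_ ?_⟩)
  · refine sub_pos.2 (lt_of_le_of_ne (Real.cos_le_one _) fun h => hj ?_)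
    have := (Real.cos_eq_one_iff_of_lt_of_lt
      (by linarith [(hk j).1, Real.pi_pos]) (by linarith [(hk j).2, Real.pi_pos])).1 h
    simpa using this
  · exact sub_pos.2 (lt_of_le_of_ne (angle_cos_le_one _)
      fun h => hq ((angle_cos_eq_one_iff _).1 h))

theorem energy_zero_nonneg {m : ℝ} (hm : 0 < m) (q : T3) : 0 ≤ energy m m 0 q := by
  rw [energy_zero_eq]
  exact mul_nonneg (by positivity) (Finset.sum_nonneg fun j _ => sub_nonneg.2 (angle_cos_le_one _))

theorem energy_zero_pos {m : ℝ} (hm : 0 < m) {q : T3} {j : Fin 3} (hq : q j ≠ 0) :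
    0 < energy m m 0 q := by
  rw [energy_zero_eq]
  exact mul_pos (by positivity) (Finset.sum_pos' (fun i _ => sub_nonneg.2 (angle_cos_le_one _))
    ⟨j, Finset.mem_univ j, sub_pos.2 (lt_of_le_of_ne (angle_cos_le_one _)
      fun h => hq ((angle_cos_eq_one_iff _).1 h))⟩)

/-! ### The singularity of the inverse band function at the origin -/

theorem integrableOn_abs_rpow {r : ℝ} (hr : -1 < r) (a : ℝ) (ha : 0 ≤ a) :
    IntegrableOn (fun x : ℝ => |x| ^ r) (Set.Ioc (-a) a) := by
  have h1 : IntervalIntegrable (fun x : ℝ => |x| ^ r) volume 0 a := by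
    refine (intervalIntegral.intervalIntegrable_rpow' hr).congr_ae ?_
    filter_upwards [ae_restrict_mem measurableSet_uIoc] with x hx
    rw [Set.uIoc_of_le ha] at hx
    rw [abs_of_pos hx.1]
  have h2 : IntervalIntegrable (fun x : ℝ => |x| ^ r) volume (-a) 0 := by
    have := ((IntervalIntegrable.iff_comp_neg (f := fun x : ℝ => |x| ^ r)).1 h1).symm
    simpa using this
  exact (intervalIntegrable_iff_integrableOn_Ioc_of_le (by linarith)).1 (h2.trans h1)

/-- Jordan's inequality gives `1 - cos x ≥ 2x²/π²`, so the singularity is at worst `|x|^(-2/3)`. The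
exponent is minus one over the dimension: the product of three such factors dominates `1/E_0` up to
a constant. -/
theorem integrable_one_sub_cos_rpow :
    Integrable (fun t : AddCircle (2 * Real.pi) => (1 - Real.Angle.cos t) ^ (-(1 / 3) : ℝ)) := by
  have hmeas : Measurable
      (fun t : AddCircle (2 * Real.pi) => (1 - Real.Angle.cos t) ^ (-(1 / 3) : ℝ)) := by
    have : Continuous fun t : AddCircle (2 * Real.pi) => 1 - Real.Angle.cos t :=
      continuous_const.sub Real.Angle.continuous_cos
    exact this.measurable.pow_const _
  have hmp := AddCircle.measurePreserving_mk (2 * Real.pi) (-Real.pi)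
  rw [show -Real.pi + 2 * Real.pi = Real.pi by ring] at hmp
  rw [← hmp.integrable_comp hmeas.aestronglyMeasurable]
  have h := (integrableOn_abs_rpow (r := -(2 / 3)) (by norm_num) Real.pi Real.pi_pos.le).const_mul
    ((2 / Real.pi ^ 2) ^ (-(1 / 3) : ℝ))
  refine h.mono' (hmeas.comp hmp.measurable).aestronglyMeasurable ?_
  filter_upwards [ae_restrict_mem measurableSet_Ioc,
    ae_restrict_of_ae (Measure.ae_ne volume (0 : ℝ))] with x hx hx0
  have h1 : 2 / Real.pi ^ 2 * |x| ^ 2 ≤ 1 - Real.cos x := by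
    have h2 : 2 / Real.pi * |x / 2| ≤ |Real.sin (x / 2)| :=
      Real.mul_abs_le_abs_sin (by rw [abs_le]; constructor <;> linarith [hx.1, hx.2])
    have h3 : Real.cos x = 1 - 2 * Real.sin (x / 2) ^ 2 := by
      have := Real.cos_two_mul (x / 2)
      rw [mul_div_cancel₀ _ (two_ne_zero)] at this
      rw [this, Real.cos_sq']; ring
    have h4 : (2 / Real.pi * |x / 2|) ^ 2 ≤ |Real.sin (x / 2)| ^ 2 := by gcongr
    rw [sq_abs] at h4
    have h5 : (2 / Real.pi * |x / 2|) ^ 2 = |x| ^ 2 / Real.pi ^ 2 := by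
      rw [abs_div, abs_two]; ring
    rw [h3]
    have : 2 / Real.pi ^ 2 * |x| ^ 2 = 2 * (|x| ^ 2 / Real.pi ^ 2) := by ring
    linarith
  have hx0' : 0 < |x| := abs_pos.2 hx0
  have hpi := Real.pi_pos
  change ‖(1 - Real.cos x) ^ (-(1 / 3) : ℝ)‖ ≤ _
  rw [Real.norm_of_nonneg (Real.rpow_nonneg (sub_nonneg.2 (Real.cos_le_one _)) _)]
  refine (Real.rpow_le_rpow_of_nonpos (by positivity) h1 (by norm_num)).trans_eq ?_
  rw [Real.mul_rpow (by positivity) (by positivity), ← Real.rpow_natCast |x| 2,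
    ← Real.rpow_mul (abs_nonneg x)]
  norm_num

/-- In dimension three the resolvent of the free operator at the bottom of its spectrum is
integrable. -/
theorem integrable_inv_energy_zero {m : ℝ} (hm : 0 < m) :
    Integrable (fun q : T3 => (energy m m 0 q)⁻¹) := by
  have h : Integrable (fun q : T3 => ∏ j, (1 - Real.Angle.cos (q j)) ^ (-(1 / 3) : ℝ)) :=
    Integrable.fintype_prod fun _ => integrable_one_sub_cos_rpow
  refine (h.const_mul (m / 2)).mono'
    (continuous_energy m m 0).measurable.inv.aestronglyMeasurable ?_
  filter_upwards [ae_ne_zero 0, ae_ne_zero 1, ae_ne_zero 2] with q h0 h1 h2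
  have hpos : ∀ j, 0 < 1 - Real.Angle.cos (q j) := by
    intro j
    refine sub_pos.2 (lt_of_le_of_ne (angle_cos_le_one _) fun h => ?_)
    rw [angle_cos_eq_one_iff] at h
    fin_cases j <;> contradiction
  set S := ∑ j, (1 - Real.Angle.cos (q j)) with hS
  have hSpos : 0 < S := Finset.sum_pos (fun j _ => hpos j) Finset.univ_nonempty
  have hle : ∀ j, 1 - Real.Angle.cos (q j) ≤ S := fun j =>
    Finset.single_le_sum (fun i _ => (hpos i).le) (Finset.mem_univ j)
  rw [Real.norm_of_nonneg (inv_nonneg.2 (energy_zero_nonneg hm q)), energy_zero_eq, ← hS, mul_inv,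
    inv_div]
  gcongr
  -- Share `S⁻¹` equally among the three coordinates, then replace `S` in each factor by the smaller
  -- summand `1 - cos (q j)`.
  calc S⁻¹ = ∏ _j : Fin 3, S ^ (-(1 / 3) : ℝ) := by
        rw [Finset.prod_const, Finset.card_univ, Fintype.card_fin, ← Real.rpow_natCast,
          ← Real.rpow_mul hSpos.le, ← Real.rpow_neg_one]
        norm_num
    _ ≤ _ := Finset.prod_le_prod (fun _ _ => by positivity) fun j _ =>
        Real.rpow_le_rpow_of_nonpos (hpos j) (hle j) (by norm_num)

theorem one_sub_cos_le_norm_sq (t : AddCircle (2 * Real.pi)) :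
    1 - Real.Angle.cos t ≤ ‖t‖ ^ 2 / 2 := by
  obtain ⟨x, rfl⟩ : ∃ x : ℝ, (x : AddCircle (2 * Real.pi)) = t := QuotientAddGroup.mk_surjective t
  rw [AddCircle.norm_eq, sq_abs]
  have h := Real.one_sub_sq_div_two_le_cos
    (x := x - round ((2 * Real.pi)⁻¹ * x) * (2 * Real.pi))
  rw [Real.cos_sub_int_mul_two_pi] at h
  change 1 - Real.cos x ≤ _
  linarith

theorem energy_zero_le {m : ℝ} (hm : 0 < m) {r : ℝ} {q : T3} (hq : ‖q‖ ≤ r) :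
    energy m m 0 q ≤ 3 / m * r ^ 2 := by
  rw [energy_zero_eq]
  have h : ∑ j, (1 - Real.Angle.cos (q j)) ≤ ∑ _j : Fin 3, r ^ 2 / 2 := by
    refine Finset.sum_le_sum fun j _ => (one_sub_cos_le_norm_sq _).trans ?_
    gcongr
    exact (norm_le_pi_norm q j).trans hq
  calc _ ≤ 2 / m * ∑ _j : Fin 3, r ^ 2 / 2 := by gcongr
    _ = _ := by simp; ring

theorem volume_real_closedBall_zero {r : ℝ} (hr : 0 ≤ r) (hr' : r ≤ Real.pi) :
    (volume : Measure T3).real (Metric.closedBall 0 r) = (2 * r) ^ 3 := by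
  rw [Measure.real, closedBall_pi _ hr, volume_pi_pi]
  simp only [AddCircle.volume_closedBall, Finset.prod_const, Finset.card_univ, Fintype.card_fin,
    ENNReal.toReal_pow]
  rw [min_eq_right (by linarith), ENNReal.toReal_ofReal (by positivity)]

/-- The inverse square of the band function is not locally integrable at its minimum. -/
theorem not_integrable_of_le_energy_zero {m : ℝ} (hm : 0 < m) {φ : T3 → ℝ} {c r₀ : ℝ} (hc : 0 < c)
    (hr₀ : 0 < r₀) (hφ0 : 0 ≤ᵐ[volume] φ)
    (hφ : ∀ᵐ q : T3, ‖q‖ ≤ r₀ → c ≤ φ q * energy m m 0 q ^ 2) : ¬ Integrable φ := by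
  intro hint
  -- On the ball of radius `r` and volume `8r³`, `E_0 ≤ 3r²/m` forces `φ ≥ c m²/(9r⁴)`. Its mass is
  -- thus at least a constant over `r`, which is unbounded as `r → 0`.
  have key : ∀ r, 0 < r → r ≤ r₀ → r ≤ Real.pi → 8 * c * m ^ 2 / 9 ≤ (∫ q, φ q) * r := by
    intro r hr hrr hrpi
    have h1 : ∫ _q in Metric.closedBall (0 : T3) r, c * m ^ 2 / (9 * r ^ 4) ≤
        ∫ q in Metric.closedBall (0 : T3) r, φ q := by
      refine setIntegral_mono_on_ae (integrable_const _).integrableOn hint.integrableOn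
        Metric.isClosed_closedBall.measurableSet ?_
      filter_upwards [hφ, hφ0, ae_ne_zero 0] with q hq hq0 hne hmem
      have hqr : ‖q‖ ≤ r := by simpa using hmem
      have h2 := hq (hqr.trans hrr)
      have h3 := energy_zero_le hm hqr
      have h4 := energy_zero_nonneg hm q
      have h5 : energy m m 0 q ^ 2 ≤ (3 / m * r ^ 2) ^ 2 := by gcongr
      have h6 : c ≤ φ q * (3 / m * r ^ 2) ^ 2 :=
        h2.trans (mul_le_mul_of_nonneg_left h5 hq0)
      rw [div_le_iff₀ (by positivity)]
      calc c * m ^ 2 ≤ φ q * (3 / m * r ^ 2) ^ 2 * m ^ 2 := by gcongr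
        _ = _ := by field_simp; ring
    have h2 : ∫ q in Metric.closedBall (0 : T3) r, φ q ≤ ∫ q, φ q :=
      setIntegral_le_integral hint hφ0
    rw [setIntegral_const, volume_real_closedBall_zero hr.le hrpi, smul_eq_mul] at h1
    have h3 : (2 * r) ^ 3 * (c * m ^ 2 / (9 * r ^ 4)) = 8 * c * m ^ 2 / 9 / r := by
      field_simp; ring
    rw [h3] at h1
    exact (div_le_iff₀ hr).1 (h1.trans h2)
  set I := ∫ q, φ q
  have hI : 0 ≤ I := integral_nonneg_of_ae hφ0
  -- Small enough that `(I + 1) r` is at most half the constant in `key`.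
  set r := min (min r₀ Real.pi) (4 * c * m ^ 2 / 9 / (I + 1))
  have hr : 0 < r := by
    have := Real.pi_pos
    positivity
  have h1 := key r hr ((min_le_left _ _).trans (min_le_left _ _))
    ((min_le_left _ _).trans (min_le_right _ _))
  have h2 : (I + 1) * r ≤ 4 * c * m ^ 2 / 9 := by
    rw [mul_comm, ← le_div_iff₀ (by positivity)]
    exact min_le_right _ _
  have h3 : 0 < c * m ^ 2 := by positivity
  nlinarith

/-! ### Reflection invariance and the Fourier normalization -/

instance : (volume : Measure T3).IsNegInvariant :=
  Measure.IsAddHaarMeasure.isNegInvariant_of_regular _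

theorem fourierConst_pos : 0 < fourierConst := Real.rpow_pos_of_pos Real.two_pi_pos _

theorem fourierConst_sq : fourierConst ^ 2 = ((2 * Real.pi) ^ 3)⁻¹ := by
  rw [fourierConst, ← Real.rpow_natCast, ← Real.rpow_mul Real.two_pi_pos.le, ← Real.rpow_natCast,
    ← Real.rpow_neg Real.two_pi_pos.le]
  norm_num

theorem fourierConst_sq_mul : fourierConst ^ 2 * (2 * Real.pi) ^ 3 = 1 := by
  rw [fourierConst_sq]
  exact inv_mul_cancel₀ (pow_pos Real.two_pi_pos 3).ne'

/-! ### Characters -/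

theorem character_add_apply (s : Fin 3 → ℤ) (p q : T3) :
    character s (p + q) = character s p * character s q := by
  simp [character, fourier_apply, AddCircle.toCircle_add, ← Finset.prod_mul_distrib]

theorem character_add (s r : Fin 3 → ℤ) (q : T3) :
    character (s + r) q = character s q * character r q := by
  simp [character, ← Finset.prod_mul_distrib]

theorem character_neg (s : Fin 3 → ℤ) (q : T3) :
    character (-s) q = starRingEnd ℂ (character s q) := by
  simp [character]

theorem character_apply_neg (s : Fin 3 → ℤ) (q : T3) :
    character s (-q) = character (-s) q := by
  simp [character, fourier_apply]

theorem norm_character_apply (s : Fin 3 → ℤ) (q : T3) : ‖character s q‖ = 1 := by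
  change ‖∏ j, fourier (s j) (q j)‖ = 1
  rw [norm_prod]
  exact Finset.prod_eq_one fun j _ => Circle.norm_coe _

theorem norm_character_le (s : Fin 3 → ℤ) : ‖character s‖ ≤ 1 :=
  (ContinuousMap.norm_le _ zero_le_one).2 fun q => (norm_character_apply s q).le

theorem character_sub_apply (s : Fin 3 → ℤ) (p q : T3) :
    character s (p - q) = character s p * starRingEnd ℂ (character s q) := by
  rw [sub_eq_add_neg, character_add_apply, character_apply_neg, character_neg]

theorem integral_character (s : Fin 3 → ℤ) :
    ∫ q, character s q = if s = 0 then ((2 * Real.pi) ^ 3 : ℂ) else 0 := by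
  have h : ∫ q, character s q = ∏ j, ∫ t : AddCircle (2 * Real.pi), fourier (s j) t :=
    integral_fintype_prod_volume_eq_prod (𝕜 := ℂ)
      fun j (t : AddCircle (2 * Real.pi)) => fourier (s j) t
  rw [h]
  split_ifs with hs
  · subst hs
    simp [Measure.real, ENNReal.toReal_ofReal Real.pi_pos.le]
  · obtain ⟨j, hj⟩ := Function.ne_iff.1 hs
    refine Finset.prod_eq_zero (Finset.mem_univ j) ?_
    exact integral_eq_zero_of_add_right_eq_neg
      (fourier_add_half_inv_index hj Real.two_pi_pos)

/-- The character `s` as an element of `L²(𝕋³)`. -/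
def charLp (s : Fin 3 → ℤ) : L2 := ContinuousMap.toLp 2 (volume : Measure T3) ℂ (character s)

theorem charLp_coeFn (s : Fin 3 → ℤ) : charLp s =ᵐ[volume] character s :=
  ContinuousMap.coeFn_toLp (p := 2) (𝕜 := ℂ) (volume : Measure T3) _

theorem inner_charLp (s r : Fin 3 → ℤ) :
    inner ℂ (charLp s) (charLp r) = if s = r then ((2 * Real.pi) ^ 3 : ℂ) else 0 := by
  rw [charLp, charLp, ContinuousMap.inner_toLp]
  simp only [← character_neg, ← character_add]
  rw [integral_character]
  simp only [add_neg_eq_zero, eq_comm]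

theorem orthonormal_charLp : Orthonormal ℂ fun s => (fourierConst : ℂ) • charLp s := by
  rw [orthonormal_iff_ite]
  intro s r
  rw [inner_smul_left, inner_smul_right, inner_charLp, Complex.conj_ofReal]
  split_ifs
  · have := fourierConst_sq_mul
    rw [← mul_assoc, ← sq]
    exact_mod_cast this
  · simp

/-! ### The decay condition -/

/-- Every finite set of indices lies in a box, over which the sum factorizes. -/
theorem summable_prod_of_nonneg {ι : Type*} [Fintype ι] {f : ℤ → ℝ} (hf : Summable f)
    (h0 : ∀ n, 0 ≤ f n) : Summable fun s : ι → ℤ => ∏ j, f (s j) := by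
  classical
  refine summable_of_sum_le (c := ∏ _j : ι, ∑' n, f n)
    (fun s => Finset.prod_nonneg fun j _ => h0 _) fun S => ?_
  have hsub : S ⊆ Fintype.piFinset fun j => S.image fun s => s j := fun s hs =>
    Fintype.mem_piFinset.2 fun j => Finset.mem_image_of_mem _ hs
  refine (Finset.sum_le_sum_of_subset_of_nonneg hsub
    fun s _ _ => Finset.prod_nonneg fun j _ => h0 _).trans ?_
  rw [← Finset.prod_univ_sum (fun j => S.image fun s => s j) fun _ n => f n]
  exact Finset.prod_le_prod (fun j _ => Finset.sum_nonneg fun n _ => h0 n)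
    fun j _ => hf.sum_le_tsum _ fun n _ => h0 n

theorem summable_abs_of_decay {vhat : (Fin 3 → ℤ) → ℝ} {κ : ℝ} (hκ : 0 < κ)
    (hdecay : Tendsto (fun s => Real.sqrt (∑ j, (s j : ℝ) ^ 2) ^ (3 + κ) * vhat s) cofinite (𝓝 0)) :
    Summable fun s => |vhat s| := by
  -- The exponent `3 + κ` is shared equally by the three coordinates; `max 1` handles vanishing
  -- ones.
  set f : ℤ → ℝ := fun n => (max 1 |(n : ℝ)|) ^ (-(1 + κ / 3)) with hf
  have hfs : Summable f := by
    refine Summable.of_norm_bounded_eventually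
      (Real.summable_abs_int_rpow (b := 1 + κ / 3) (by linarith)) ?_
    refine (Set.finite_singleton (0 : ℤ)).subset fun n hn => ?_
    by_contra hn0
    apply hn
    have h1 : (1 : ℝ) ≤ |(n : ℝ)| := by
      exact_mod_cast Int.one_le_abs (show n ≠ 0 from hn0)
    change ‖f n‖ ≤ _
    simp only [hf, max_eq_right h1]
    rw [Real.norm_of_nonneg (by positivity)]
  have hsum := summable_prod_of_nonneg (ι := Fin 3) hfs fun n => by positivity
  refine Summable.of_norm_bounded_eventually hsum ?_
  have h1 := hdecay.norm.eventually (gt_mem_nhds (show ‖(0 : ℝ)‖ < 1 by simp))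
  have h2 : ∀ᶠ s : Fin 3 → ℤ in cofinite, s ≠ 0 :=
    (Set.finite_singleton (0 : Fin 3 → ℤ)).subset fun s hs => by simpa using hs
  filter_upwards [h1, h2] with s hs hs0
  set R := Real.sqrt (∑ j, (s j : ℝ) ^ 2) with hR
  have hle : ∀ j, |(s j : ℝ)| ≤ R := fun j => by
    rw [← Real.sqrt_sq_eq_abs]
    exact Real.sqrt_le_sqrt (Finset.single_le_sum (f := fun j => (s j : ℝ) ^ 2)
      (fun i _ => sq_nonneg _) (Finset.mem_univ j))
  have hR1 : 1 ≤ R := by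
    obtain ⟨j, hj⟩ := Function.ne_iff.1 hs0
    refine le_trans ?_ (hle j)
    exact_mod_cast Int.one_le_abs (show s j ≠ 0 from hj)
  have hRpos : 0 < R := by linarith
  rw [norm_mul, Real.norm_of_nonneg (by positivity), mul_comm, ← lt_div_iff₀ (by positivity),
    one_div, ← Real.rpow_neg hRpos.le] at hs
  rw [norm_abs_eq_norm]
  refine hs.le.trans ?_
  calc R ^ (-(3 + κ)) = ∏ _j : Fin 3, R ^ (-(1 + κ / 3)) := by
        rw [Finset.prod_const, Finset.card_univ, Fintype.card_fin, ← Real.rpow_natCast,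
          ← Real.rpow_mul hRpos.le]
        congr 1
        push_cast
        ring
    _ ≤ _ := Finset.prod_le_prod (fun _ _ => by positivity) fun j _ =>
        Real.rpow_le_rpow_of_nonpos (by positivity) (max_le hR1 (hle j)) (by linarith)

/-! ### Integrals of products of square-integrable functions -/

theorem integrable_mul_of_memLp_two {u v : T3 → ℂ} (hu : MemLp u 2) (hv : MemLp v 2) :
    Integrable (fun q => u q * v q) := hu.integrable_mul hv

theorem integral_norm_mul_le {u v : T3 → ℂ} (hu : MemLp u 2) (hv : MemLp v 2) :
    ∫ q, ‖u q‖ * ‖v q‖ ≤ (eLpNorm u 2 volume).toReal * (eLpNorm v 2 volume).toReal := by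
  have h := real_inner_le_norm (hu.norm.toLp _) (hv.norm.toLp _)
  rw [L2.inner_def, Lp.norm_toLp, Lp.norm_toLp, eLpNorm_norm, eLpNorm_norm] at h
  refine le_trans (le_of_eq ?_) h
  refine integral_congr_ae ?_
  filter_upwards [hu.norm.coeFn_toLp, hv.norm.coeFn_toLp] with q h1 h2
  rw [h1, h2]
  simp [mul_comm]

theorem memLp_comp_sub_left (u : L2) (x : T3) : MemLp (fun q => u (x - q)) 2 :=
  (Lp.memLp u).comp_measurePreserving (Measure.measurePreserving_sub_left volume x)

theorem memLp_comp_sub_right (u : L2) (x : T3) : MemLp (fun q => u (q - x)) 2 :=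
  (Lp.memLp u).comp_measurePreserving (measurePreserving_sub_right volume x)

theorem eLpNorm_comp_sub_left (u : L2) (x : T3) :
    (eLpNorm (fun q => u (x - q)) 2 volume).toReal = ‖u‖ := by
  rw [Lp.norm_def]
  congr 1
  exact eLpNorm_comp_measurePreserving (Lp.aestronglyMeasurable u)
    (Measure.measurePreserving_sub_left volume x)

theorem eLpNorm_comp_sub_right (u : L2) (x : T3) :
    (eLpNorm (fun q => u (q - x)) 2 volume).toReal = ‖u‖ := by
  rw [Lp.norm_def]
  congr 1
  exact eLpNorm_comp_measurePreserving (Lp.aestronglyMeasurable u)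
    (measurePreserving_sub_right volume x)

theorem exists_integral_norm_le : ∃ C, 0 ≤ C ∧ ∀ f : L2, ∫ q, ‖f q‖ ≤ C * ‖f‖ := by
  refine ⟨(eLpNorm (fun _ : T3 => (1 : ℂ)) 2 volume).toReal, ENNReal.toReal_nonneg, fun f => ?_⟩
  have h := integral_norm_mul_le (memLp_const (1 : ℂ)) (Lp.memLp f)
  simpa [Lp.norm_def] using h

/-! ### The interaction -/

theorem convFun_apply (g : C(T3, ℂ)) (f : L2) (q : T3) :
    convFun g f q = (fourierConst : ℂ) * ∫ s, g (q - s) * f s := rfl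

theorem convFun_add_left (g g' : C(T3, ℂ)) (f : L2) :
    convFun (g + g') f = convFun g f + convFun g' f := by
  ext q
  simp only [convFun_apply, ContinuousMap.add_apply, add_mul, ← mul_add]
  rw [integral_add (integrable_kernel_mul g f q) (integrable_kernel_mul g' f q)]

theorem convFun_smul_left (a : ℂ) (g : C(T3, ℂ)) (f : L2) :
    convFun (a • g) f = a • convFun g f := by
  ext q
  simp only [convFun_apply, ContinuousMap.smul_apply, smul_eq_mul, mul_assoc]
  rw [integral_const_mul, mul_left_comm]

theorem convOp_apply (g : C(T3, ℂ)) (f : L2) :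
    convOp g f = ContinuousMap.toLp 2 (volume : Measure T3) ℂ (convFun g f) := rfl

theorem norm_convFun_le {C : ℝ} (hC : ∀ f : L2, ∫ q, ‖f q‖ ≤ C * ‖f‖) (hC0 : 0 ≤ C)
    (g : C(T3, ℂ)) (f : L2) : ‖convFun g f‖ ≤ fourierConst * (‖g‖ * (C * ‖f‖)) := by
  have hc := fourierConst_pos
  refine (ContinuousMap.norm_le _ (by positivity)).2 fun q => ?_
  rw [convFun_apply, norm_mul, Complex.norm_real, Real.norm_of_nonneg hc.le]
  gcongr
  calc ‖∫ s, g (q - s) * f s‖ ≤ ∫ s, ‖g‖ * ‖f s‖ := by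
        refine norm_integral_le_of_norm_le ((integrable_coeFn f).norm.const_mul _)
          (.of_forall fun s => ?_)
        rw [norm_mul]
        gcongr
        exact g.norm_coe_le_norm _
    _ = ‖g‖ * ∫ s, ‖f s‖ := integral_const_mul _ _
    _ ≤ _ := by gcongr; exact hC f

/-- Convolution as a bounded operator valued function of the kernel. -/
def convCLM : C(T3, ℂ) →L[ℂ] L2 →L[ℂ] L2 :=
  LinearMap.mkContinuousOfExistsBound
    { toFun := convOp
      map_add' := fun g g' => by
        ext1 f
        simp only [convOp_apply, add_apply, convFun_add_left, map_add]
      map_smul' := fun a g => by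
        ext1 f
        simp only [convOp_apply, smul_apply, convFun_smul_left, map_smul, RingHom.id_apply] } <| by
    obtain ⟨C, hC0, hC⟩ := exists_integral_norm_le
    have hc := fourierConst_pos
    refine ⟨‖ContinuousMap.toLp 2 (volume : Measure T3) ℂ (E := ℂ)‖ * (fourierConst * C),
      fun g => ContinuousLinearMap.opNorm_le_bound _ (by positivity) fun f => ?_⟩
    refine ((ContinuousMap.toLp 2 (volume : Measure T3) ℂ).le_opNorm (convFun g f)).trans ?_
    calc _ ≤ ‖ContinuousMap.toLp 2 (volume : Measure T3) ℂ (E := ℂ)‖ *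
          (fourierConst * (‖g‖ * (C * ‖f‖))) := by
          gcongr; exact norm_convFun_le hC hC0 g f
      _ = _ := by ring

theorem convCLM_apply (g : C(T3, ℂ)) : convCLM g = convOp g := rfl

theorem inner_charLp_left (s : Fin 3 → ℤ) (f : L2) :
    inner ℂ (charLp s) f = ∫ q, starRingEnd ℂ (character s q) * f q := by
  rw [L2.inner_def]
  refine integral_congr_ae ?_
  filter_upwards [charLp_coeFn s] with q hq
  rw [hq, RCLike.inner_apply, mul_comm]

theorem convOp_character (s : Fin 3 → ℤ) :
    convOp (character s) =
      ((fourierConst : ℂ) • innerSL ℂ (charLp s)).smulRight (charLp s) := by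
  ext1 f
  have h : convFun (character s) f = ((fourierConst : ℂ) * inner ℂ (charLp s) f) • character s := by
    ext q
    rw [convFun_apply, ContinuousMap.smul_apply, smul_eq_mul, inner_charLp_left, mul_assoc,
      ← integral_mul_const]
    congr 1
    refine integral_congr_ae (.of_forall fun t => ?_)
    simp only [character_sub_apply]
    ring
  rw [convOp_apply, h, map_smul]
  rfl

theorem isCompactOperator_convOp_character (s : Fin 3 → ℤ) :
    IsCompactOperator (convOp (character s)) := by
  rw [convOp_character]
  have h : IsCompactOperator ((fourierConst : ℂ) • innerSL ℂ (charLp s)) :=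
    isCompactOperator_of_locallyCompactSpace_dom _
  exact h.clm_comp (ContinuousLinearMap.toSpanSingleton ℂ (charLp s))

theorem hasSum_potentialKernel {vhat : (Fin 3 → ℤ) → ℝ} (hs : Summable fun s => |vhat s|) :
    HasSum (fun s => ((fourierConst * vhat s : ℝ) : ℂ) • character s) (potentialKernel vhat) := by
  have h : Summable fun s => (vhat s : ℂ) • character s := by
    refine Summable.of_norm_bounded hs fun s => ?_
    rw [norm_smul, Complex.norm_real, Real.norm_eq_abs]
    exact mul_le_of_le_one_right (abs_nonneg _) (norm_character_le s)
  have h2 := h.hasSum.const_smul (fourierConst : ℂ)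
  simp only [smul_smul, ← Complex.ofReal_mul] at h2
  exact h2

theorem hasSum_potentialKernel_apply {vhat : (Fin 3 → ℤ) → ℝ} (hs : Summable fun s => |vhat s|)
    (q : T3) :
    HasSum (fun s => ((fourierConst * vhat s : ℝ) : ℂ) * character s q)
      (potentialKernel vhat q) :=
  (hasSum_potentialKernel hs).mapL (ContinuousMap.evalCLM ℂ q)

theorem hasSum_interaction {vhat : (Fin 3 → ℤ) → ℝ} (hs : Summable fun s => |vhat s|) :
    HasSum (fun s => ((fourierConst * vhat s : ℝ) : ℂ) • convOp (character s))
      (interaction vhat) := by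
  have h := (hasSum_potentialKernel hs).mapL convCLM
  simp only [map_smul, convCLM_apply] at h
  exact h

/-- Summability of `v̂` makes `V` an operator-norm limit of finite sums of the rank-one convolutions
by characters. -/
theorem isCompactOperator_interaction {vhat : (Fin 3 → ℤ) → ℝ}
    (hs : Summable fun s => |vhat s|) : IsCompactOperator (interaction vhat) := by
  refine isCompactOperator_of_tendsto (hasSum_interaction hs) (.of_forall fun S => ?_)
  exact (compactOperator (RingHom.id ℂ) L2 L2).sum_mem
    fun s _ => (compactOperator (RingHom.id ℂ) L2 L2).smul_mem _
      (isCompactOperator_convOp_character s)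

theorem interaction_charLp {vhat : (Fin 3 → ℤ) → ℝ} (hs : Summable fun s => |vhat s|)
    (r : Fin 3 → ℤ) : interaction vhat (charLp r) = (vhat r : ℂ) • charLp r := by
  have h := (hasSum_interaction hs).mapL (ContinuousLinearMap.apply ℂ L2 (charLp r))
  refine h.unique ?_
  have h2 := hasSum_single (f := fun s => ContinuousLinearMap.apply ℂ L2 (charLp r)
    (((fourierConst * vhat s : ℝ) : ℂ) • convOp (character s))) r fun s hsr => by
      simp [convOp_character, inner_charLp, hsr]
  convert h2 using 1
  have h3 : ((fourierConst : ℂ) ^ 2 * (2 * Real.pi) ^ 3) = 1 := by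
    exact_mod_cast fourierConst_sq_mul
  simp only [ContinuousLinearMap.apply_apply, smul_apply, convOp_character,
    ContinuousLinearMap.smulRight_apply, innerSL_apply_apply, inner_charLp, if_true, smul_smul,
    smul_eq_mul]
  congr 1
  push_cast
  linear_combination (-(vhat r : ℂ)) * h3

/-- The characters are eigenvectors of `V` with eigenvalues `v̂(r)`. Hence `Real.sqrt (vhat r)` is a
genuine square root. -/
theorem vhat_nonneg {vhat : (Fin 3 → ℤ) → ℝ} (hs : Summable fun s => |vhat s|)
    (hV : (interaction vhat).IsPositive) (r : Fin 3 → ℤ) : 0 ≤ vhat r := by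
  have h := hV.re_inner_nonneg_left (charLp r)
  have h1 : inner ℂ (interaction vhat (charLp r)) (charLp r) =
      ((vhat r * (2 * Real.pi) ^ 3 : ℝ) : ℂ) := by
    rw [interaction_charLp hs, inner_smul_left, inner_charLp, if_pos rfl, Complex.conj_ofReal]
    push_cast
    rfl
  rw [h1] at h
  change 0 ≤ vhat r * (2 * Real.pi) ^ 3 at h
  exact nonneg_of_mul_nonneg_left h (pow_pos Real.two_pi_pos 3)

/-! ### The kernel of the square root of the interaction -/

theorem hasSum_sqrtKernel {vhat : (Fin 3 → ℤ) → ℝ} (hs : Summable fun s => |vhat s|) :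
    HasSum (fun s => ((fourierConst * Real.sqrt (vhat s) : ℝ) : ℂ) • charLp s)
      (sqrtKernel vhat) := by
  have hc : (fourierConst : ℂ) ≠ 0 := by exact_mod_cast fourierConst_pos.ne'
  have h : Summable fun s => ((Real.sqrt (vhat s) : ℝ) : ℂ) • (fourierConst : ℂ) • charLp s := by
    refine (orthonormal_charLp.orthogonalFamily.summable_iff_norm_sq_summable
      fun s => ((Real.sqrt (vhat s) : ℝ) : ℂ)).2 ?_
    refine Summable.of_nonneg_of_le (fun s => by positivity) (fun s => ?_) hs
    rw [Complex.norm_real, Real.norm_of_nonneg (Real.sqrt_nonneg _), sq]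
    rcases le_total 0 (vhat s) with h0 | h0
    · rw [Real.mul_self_sqrt h0]; exact le_abs_self _
    · rw [Real.sqrt_eq_zero_of_nonpos h0]; simp
  have h1 : Summable fun s => ((Real.sqrt (vhat s) : ℝ) : ℂ) • charLp s := by
    have := h.const_smul ((fourierConst : ℂ)⁻¹)
    refine this.congr fun s => ?_
    rw [smul_comm ((Real.sqrt (vhat s) : ℝ) : ℂ), inv_smul_smul₀ hc]
  have h2 := h1.hasSum.const_smul (fourierConst : ℂ)
  simp only [smul_smul, ← Complex.ofReal_mul] at h2
  exact h2

theorem inner_charLp_sqrtKernel {vhat : (Fin 3 → ℤ) → ℝ} (hs : Summable fun s => |vhat s|)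
    (r : Fin 3 → ℤ) :
    (fourierConst : ℂ) * inner ℂ (charLp r) (sqrtKernel vhat) = Real.sqrt (vhat r) := by
  have h := ((hasSum_sqrtKernel hs).mapL (innerSL ℂ (charLp r))).mul_left (fourierConst : ℂ)
  refine h.unique ?_
  have h2 := hasSum_single (f := fun s => (fourierConst : ℂ) * innerSL ℂ (charLp r)
    (((fourierConst * Real.sqrt (vhat s) : ℝ) : ℂ) • charLp s)) r fun s hsr => by
      simp [inner_charLp, hsr.symm]
  have h3 : ((fourierConst : ℂ) ^ 2 * (2 * Real.pi) ^ 3) = 1 := by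
    exact_mod_cast fourierConst_sq_mul
  have h4 : (fourierConst : ℂ) * innerSL ℂ (charLp r)
      (((fourierConst * Real.sqrt (vhat r) : ℝ) : ℂ) • charLp r) = Real.sqrt (vhat r) := by
    simp only [map_smul, innerSL_apply_apply, inner_charLp, if_true, smul_eq_mul]
    push_cast
    linear_combination (Real.sqrt (vhat r) : ℂ) * h3
  rw [h4] at h2
  exact h2

/-- Reflection exchanges the characters `s` and `-s`, whose coefficients agree. -/
theorem sqrtKernel_neg {vhat : (Fin 3 → ℤ) → ℝ} (hs : Summable fun s => |vhat s|)
    (heven : ∀ s, vhat (-s) = vhat s) :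
    ∀ᵐ q, sqrtKernel vhat (-q) = sqrtKernel vhat q := by
  have hneg := Measure.measurePreserving_neg (volume : Measure T3)
  let U : L2 →ₗᵢ[ℂ] L2 := Lp.compMeasurePreservingₗᵢ ℂ (fun q : T3 => -q) hneg
  have hU : ∀ f : L2, U f =ᵐ[volume] fun q => f (-q) :=
    fun f => Lp.coeFn_compMeasurePreserving f hneg
  have hchar : ∀ s, U (charLp s) = charLp (-s) := fun s => by
    refine Lp.ext ?_
    filter_upwards [hU (charLp s), charLp_coeFn (-s),
      hneg.quasiMeasurePreserving.ae (charLp_coeFn s)] with q h1 h2 h3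
    rw [h1, h2, h3, character_apply_neg]
  have h1 := (hasSum_sqrtKernel hs).mapL U.toContinuousLinearMap
  have h2 := (Equiv.neg (Fin 3 → ℤ)).hasSum_iff.2 (hasSum_sqrtKernel hs)
  have h3 : U (sqrtKernel vhat) = sqrtKernel vhat := by
    refine h1.unique (h2.congr_fun ?_ )
    intro s
    simp [heven, hchar]
  have h4 := hU (sqrtKernel vhat)
  rw [h3] at h4
  exact h4.mono fun q hq => hq.symm

/-- The convolution square of `v^(1/2)` is `v`. -/
theorem integral_sqrtKernel_mul {vhat : (Fin 3 → ℤ) → ℝ} (hs : Summable fun s => |vhat s|)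
    (h0 : ∀ s, 0 ≤ vhat s) (x : T3) :
    (fourierConst : ℂ) * ∫ p, sqrtKernel vhat (x - p) * sqrtKernel vhat p =
      potentialKernel vhat x := by
  set w := sqrtKernel vhat with hw
  have ha : MemLp (fun p => starRingEnd ℂ (w (x - p))) 2 :=
    (memLp_comp_sub_left w x).star
  -- Conjugating turns the convolution integral into an inner product with `a`, so the `L²` series
  -- of `w` may be integrated term by term.
  let a : L2 := ha.toLp _
  have hinner : ∀ b : L2, inner ℂ a b = ∫ p, w (x - p) * b p := fun b => by
    rw [L2.inner_def]
    refine integral_congr_ae ?_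
    filter_upwards [ha.coeFn_toLp] with p hp
    rw [hp, RCLike.inner_apply, RingHomCompTriple.comp_apply, mul_comm]
    rfl
  have h1 := ((hasSum_sqrtKernel hs).mapL (innerSL ℂ a)).mul_left (fourierConst : ℂ)
  rw [innerSL_apply_apply, hinner] at h1
  refine h1.unique ((hasSum_potentialKernel_apply hs x).congr_fun ?_)
  intro s
  have h2 : inner ℂ a (charLp s) = character s x * inner ℂ (charLp s) w := by
    rw [hinner, inner_charLp_left, ← integral_const_mul,
      ← integral_sub_left_eq_self (fun p => character s x * (starRingEnd ℂ (character s p) * w p))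
        volume x]
    refine integral_congr_ae ?_
    filter_upwards [charLp_coeFn s] with p hp
    rw [hp, character_sub_apply, map_mul, Complex.conj_conj, ← mul_assoc, ← mul_assoc,
      Complex.mul_conj']
    simp [norm_character_apply, mul_comm]
  have h3 := inner_charLp_sqrtKernel hs s
  have h4 : (Real.sqrt (vhat s) : ℂ) * Real.sqrt (vhat s) = vhat s := by
    exact_mod_cast Real.mul_self_sqrt (h0 s)
  rw [map_smul, innerSL_apply_apply, h2, smul_eq_mul]
  push_cast
  linear_combination (fourierConst * Real.sqrt (vhat s) * character s x : ℂ) * h3 +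
    fourierConst * character s x * h4

theorem integral_sqrtKernel_mul_sub {vhat : (Fin 3 → ℤ) → ℝ} (hs : Summable fun s => |vhat s|)
    (h0 : ∀ s, 0 ≤ vhat s) (t s : T3) :
    (fourierConst : ℂ) * ∫ p, sqrtKernel vhat (t - p) * sqrtKernel vhat (p - s) =
      potentialKernel vhat (t - s) := by
  rw [← integral_sqrtKernel_mul hs h0, ← integral_sub_right_eq_self (fun p =>
    sqrtKernel vhat (t - s - p) * sqrtKernel vhat p) s]
  simp only [sub_sub_sub_cancel_right]

/-! ### Quadratic forms and positivity of the fibers -/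

theorem inner_freeOp_self (m₁ m₂ : ℝ) (k : Fin 3 → ℝ) (f : L2) :
    inner ℂ (freeOp m₁ m₂ k f) f = ((∫ q, energy m₁ m₂ k q * ‖f q‖ ^ 2 : ℝ) : ℂ) := by
  rw [L2.inner_def, ← integral_complex_ofReal]
  refine integral_congr_ae ?_
  filter_upwards [freeOp_coeFn m₁ m₂ k f] with q hq
  rw [hq, RCLike.inner_apply, map_mul, Complex.conj_ofReal, mul_left_comm, Complex.mul_conj']
  push_cast
  rfl

theorem inner_self_eq_integral (f : L2) :
    inner ℂ f f = ((∫ q, ‖f q‖ ^ 2 : ℝ) : ℂ) := by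
  rw [L2.inner_def, ← integral_complex_ofReal]
  refine integral_congr_ae (.of_forall fun q => ?_)
  simp only [RCLike.inner_apply, Complex.mul_conj']
  push_cast
  rfl

theorem norm_sq_eq_integral (f : L2) : ‖f‖ ^ 2 = ∫ q, ‖f q‖ ^ 2 := by
  have h := inner_self_eq_integral f
  rw [inner_self_eq_norm_sq_to_K] at h
  refine Complex.ofReal_injective (Eq.trans ?_ h)
  push_cast
  rfl

theorem isSymmetric_freeOp (m₁ m₂ : ℝ) (k : Fin 3 → ℝ) :
    (freeOp m₁ m₂ k : L2 →ₗ[ℂ] L2).IsSymmetric := fun f g => by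
  simp only [ContinuousLinearMap.coe_coe]
  rw [L2.inner_def, L2.inner_def]
  refine integral_congr_ae ?_
  filter_upwards [freeOp_coeFn m₁ m₂ k f, freeOp_coeFn m₁ m₂ k g] with q h1 h2
  rw [h1, h2]
  simp only [RCLike.inner_apply, map_mul, Complex.conj_ofReal]
  ring

theorem integrable_norm_sq (f : L2) : Integrable fun q => ‖f q‖ ^ 2 :=
  (memLp_two_iff_integrable_sq_norm (Lp.aestronglyMeasurable f)).1 (Lp.memLp f)

theorem integrable_mul_norm_sq {g : T3 → ℝ} (hg : Continuous g) (f : L2) :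
    Integrable fun q => g q * ‖f q‖ ^ 2 := by
  obtain ⟨C, hC⟩ := isCompact_univ.exists_bound_of_continuousOn hg.continuousOn
  exact (integrable_norm_sq f).bdd_mul (c := C) hg.aestronglyMeasurable
    (.of_forall fun q => hC q (Set.mem_univ q))

/-- Translation `f ↦ f(· + a)` on `L²(𝕋³)`. -/
def translation (a : T3) : L2 →ₗᵢ[ℂ] L2 :=
  Lp.compMeasurePreservingₗᵢ ℂ (fun q : T3 => q + a) (measurePreserving_add_right volume a)

theorem translation_coeFn (a : T3) (f : L2) : translation a f =ᵐ[volume] fun q => f (q + a) :=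
  Lp.coeFn_compMeasurePreserving f (measurePreserving_add_right volume a)

theorem convOp_translation (g : C(T3, ℂ)) (a : T3) (f : L2) :
    convOp g (translation a f) = translation a (convOp g f) := by
  have hmp := measurePreserving_add_right (volume : Measure T3) a
  refine Lp.ext ?_
  filter_upwards [convOp_coeFn g (translation a f), translation_coeFn a (convOp g f),
    hmp.quasiMeasurePreserving.ae (convOp_coeFn g f)] with q h1 h2 h3
  rw [h1, h2, h3, ← integral_add_right_eq_self (fun s => g (q + a - s) * f s) a]
  congr 1
  refine integral_congr_ae ?_
  filter_upwards [translation_coeFn a f] with s hs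
  rw [hs, add_sub_add_right_eq_sub]

theorem integral_mul_norm_sq_translation (g : T3 → ℝ) (a : T3) (f : L2) :
    ∫ q, g q * ‖translation a f q‖ ^ 2 = ∫ q, g (q - a) * ‖f q‖ ^ 2 := by
  rw [← integral_add_right_eq_self (fun q => g (q - a) * ‖f q‖ ^ 2) a]
  refine integral_congr_ae ?_
  filter_upwards [translation_coeFn a f] with q hq
  rw [hq, add_sub_cancel_right]

/-- The dispersion is even, so both summands of `E_k` are translates of `ε / m`, while `E_0 = 2ε /
m`. -/
theorem energy_eq_average (m : ℝ) (k : Fin 3 → ℝ) (q : T3) :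
    energy m m k q =
      1 / 2 * (energy m m 0 (q - halfPoint k) + energy m m 0 (q - -halfPoint k)) := by
  have h0 : halfPoint 0 = 0 := by
    funext j
    simp [halfPoint]
  have h1 := dispersion_neg (q - halfPoint k)
  have h2 := dispersion_neg (q + halfPoint k)
  rw [neg_sub] at h1
  simp only [energy, h0, zero_add, zero_sub, sub_neg_eq_add, neg_sub, h2, ← h1]
  rw [add_comm q]
  ring

/-- The fiber Hamiltonian at `k` is an average of translates of the one at `0`. -/
theorem re_inner_hamiltonian_nonneg {m : ℝ} {vhat : (Fin 3 → ℤ) → ℝ}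
    (hH : (hamiltonian m m vhat 0).IsPositive) (k : Fin 3 → ℝ) (f : L2) :
    0 ≤ (inner ℂ (hamiltonian m m vhat k f) f).re := by
  have key : ∀ a : T3, 0 ≤ (∫ q, energy m m 0 (q - a) * ‖f q‖ ^ 2) -
      (inner ℂ (interaction vhat f) f).re := fun a => by
    have h := hH.re_inner_nonneg_left (translation a f)
    rw [hamiltonian, sub_apply, inner_sub_left, inner_freeOp_self,
      integral_mul_norm_sq_translation, interaction, convOp_translation,
      LinearIsometry.inner_map_map] at h
    exact h
  have h1 := key (halfPoint k)
  have h2 := key (-halfPoint k)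
  have hcont : ∀ a : T3, Continuous fun q : T3 => energy m m 0 (q - a) := fun a =>
    (continuous_energy m m 0).comp (continuous_id.sub continuous_const)
  rw [hamiltonian, sub_apply, inner_sub_left, inner_freeOp_self, Complex.sub_re,
    Complex.ofReal_re]
  have h3 : ∫ q, energy m m k q * ‖f q‖ ^ 2 =
      1 / 2 * ((∫ q, energy m m 0 (q - halfPoint k) * ‖f q‖ ^ 2) +
        ∫ q, energy m m 0 (q - -halfPoint k) * ‖f q‖ ^ 2) := by
    rw [← integral_add (integrable_mul_norm_sq (hcont _) f) (integrable_mul_norm_sq (hcont _) f),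
      ← integral_const_mul]
    refine integral_congr_ae (.of_forall fun q => ?_)
    simp only [energy_eq_average m k q]
    ring
  rw [h3]
  linarith

/-! ### Comparison of `H(k) - E_min(k)` with `H(0)` -/

/-- The band function measured from its bottom, as a multiplication operator. -/
def shiftedFreeOp (m : ℝ) (k : Fin 3 → ℝ) : L2 →L[ℂ] L2 :=
  freeOp m m k - (energyMin m m k : ℂ) • ContinuousLinearMap.id ℂ L2

theorem isPositive_shiftedFreeOp (m : ℝ) (k : Fin 3 → ℝ) : (shiftedFreeOp m k).IsPositive := by
  refine ⟨fun f g => ?_, fun f => ?_⟩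
  · have h := isSymmetric_freeOp m m k f g
    simp only [ContinuousLinearMap.coe_coe] at h
    simp only [shiftedFreeOp, ContinuousLinearMap.coe_coe, sub_apply, smul_apply,
      ContinuousLinearMap.id_apply, inner_sub_left, inner_sub_right, inner_smul_left,
      inner_smul_right, Complex.conj_ofReal, h]
  · change 0 ≤ (inner ℂ (shiftedFreeOp m k f) f).re
    rw [shiftedFreeOp, sub_apply, inner_sub_left, smul_apply, inner_smul_left,
      Complex.conj_ofReal, ContinuousLinearMap.id_apply, inner_freeOp_self,
      inner_self_eq_integral, ← Complex.ofReal_mul, ← Complex.ofReal_sub, Complex.ofReal_re,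
      sub_nonneg, ← integral_const_mul]
    refine integral_mono ((integrable_norm_sq f).const_mul _)
      (integrable_mul_norm_sq (continuous_energy m m k) f) fun q => ?_
    exact mul_le_mul_of_nonneg_right ((energyMin_isLeast m m k).2 ⟨q, rfl⟩) (by positivity)

theorem re_inner_shifted {m : ℝ} (hm : 0 < m) {vhat : (Fin 3 → ℤ) → ℝ} {k : Fin 3 → ℝ}
    (hk : ∀ j, k j ∈ Set.Ioo (-Real.pi) Real.pi) (f : L2) :
    (inner ℂ ((shiftedFreeOp m k - interaction vhat) f) f).re =
      (inner ℂ (hamiltonian m m vhat 0 f) f).re - ∫ q, energyGap m k q * ‖f q‖ ^ 2 := by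
  rw [sub_apply, inner_sub_left, shiftedFreeOp, sub_apply, inner_sub_left, smul_apply,
    inner_smul_left, Complex.conj_ofReal, ContinuousLinearMap.id_apply, inner_freeOp_self,
    inner_self_eq_integral, hamiltonian, sub_apply, inner_sub_left, inner_freeOp_self,
    ← Complex.ofReal_mul, ← Complex.ofReal_sub, Complex.sub_re, Complex.sub_re, Complex.ofReal_re,
    Complex.ofReal_re, ← integral_const_mul,
    ← integral_sub (integrable_mul_norm_sq (continuous_energy m m k) f)
      ((integrable_norm_sq f).const_mul _)]
  have h : ∫ q, (energy m m k q * ‖f q‖ ^ 2 - energyMin m m k * ‖f q‖ ^ 2) =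
      (∫ q, energy m m 0 q * ‖f q‖ ^ 2) - ∫ q, energyGap m k q * ‖f q‖ ^ 2 := by
    rw [← integral_sub (integrable_mul_norm_sq (continuous_energy m m 0) f)
      (integrable_mul_norm_sq (continuous_energyGap m k) f)]
    refine integral_congr_ae (.of_forall fun q => ?_)
    simp only [← sub_mul, energy_sub_energyMin hm hk]
  rw [h]
  ring

/-- Reduction of the theorem to a subspace on which the form of `H(k) - E_min(k)` is negative. -/
theorem exists_eigenvalues_of_form_neg {m : ℝ} {vhat : (Fin 3 → ℤ) → ℝ}
    (hs : Summable fun s => |vhat s|) (hV : (interaction vhat).IsPositive)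
    (hH : (hamiltonian m m vhat 0).IsPositive) {k : Fin 3 → ℝ} {F : Type*} [AddCommGroup F]
    [Module ℂ F] [FiniteDimensional ℂ F] (T : F →ₗ[ℂ] L2)
    (hT : ∀ x, x ≠ 0 →
      (inner ℂ ((shiftedFreeOp m k - interaction vhat) (T x)) (T x)).re < 0) {N : ℕ}
    (hN : N ≤ Module.finrank ℂ F) :
    ∃ (μ : Fin N → ℝ) (f : Fin N → L2), Orthonormal ℂ f ∧
      ∀ i, hamiltonian m m vhat k (f i) = (μ i : ℂ) • f i ∧
        0 ≤ μ i ∧ μ i < energyMin m m k := by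
  obtain ⟨μ, f, hf, h⟩ := exists_orthonormal_eigenvectors_neg N (isPositive_shiftedFreeOp m k)
    hV.isSymmetric (isCompactOperator_interaction hs) T hT hN
  have heig : ∀ i, hamiltonian m m vhat k (f i) = ((μ i + energyMin m m k : ℝ) : ℂ) • f i :=
    fun i => by
      have h1 := (h i).1
      rw [shiftedFreeOp, sub_apply, sub_apply, smul_apply, ContinuousLinearMap.id_apply] at h1
      rw [hamiltonian, sub_apply, Complex.ofReal_add, add_smul, ← h1]
      abel
  refine ⟨fun i => μ i + energyMin m m k, f, hf, fun i => ⟨heig i, ?_, by linarith [(h i).2]⟩⟩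
  -- At a unit eigenvector the form of `H(k)` is the eigenvalue.
  have h2 := re_inner_hamiltonian_nonneg hH k (f i)
  rw [heig i, inner_smul_left, inner_self_eq_norm_sq_to_K, hf.1 i] at h2
  simpa using h2

/-! ### The resonance function -/

/-- Fubini's theorem for a square-integrable function, a family of uniformly square-integrable
functions and an integrable function. -/
theorem integral_mul_integral_mul_swap {u g : T3 → ℂ} {B : T3 → T3 → ℂ} (hu : MemLp u 2)
    (hg : Integrable g) (hB : StronglyMeasurable (Function.uncurry B))
    (hB2 : ∀ y, MemLp (fun x => B x y) 2) {C : ℝ}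
    (hC : ∀ y, (eLpNorm (fun x => B x y) 2 volume).toReal ≤ C) :
    ∫ x, u x * ∫ y, B x y * g y = ∫ y, (∫ x, u x * B x y) * g y := by
  have hmeas : AEStronglyMeasurable (Function.uncurry fun x y => u x * B x y * g y)
      ((volume : Measure T3).prod volume) :=
    (hu.aestronglyMeasurable.comp_fst.mul hB.aestronglyMeasurable).mul
      hg.aestronglyMeasurable.comp_snd
  have hint : Integrable (Function.uncurry fun x y => u x * B x y * g y)
      ((volume : Measure T3).prod volume) := by
    refine (integrable_prod_iff' hmeas).2 ⟨.of_forall fun y => ?_, ?_⟩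
    · exact (integrable_mul_of_memLp_two hu (hB2 y)).mul_const (g y)
    · refine (hg.norm.const_mul ((eLpNorm u 2 volume).toReal * C)).mono'
        hmeas.prod_swap.norm.integral_prod_right' (.of_forall fun y => ?_)
      rw [Real.norm_of_nonneg (integral_nonneg fun x => norm_nonneg _)]
      simp only [Function.uncurry_apply_pair, norm_mul]
      rw [integral_mul_const]
      gcongr
      exact (integral_norm_mul_le hu (hB2 y)).trans (by gcongr; exact hC y)
  have h := integral_integral_swap hint
  simp only [mul_assoc, integral_const_mul] at h
  simpa only [mul_assoc, ← integral_mul_const] using h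

/-- The unnormalized convolution `t ↦ ∫ w(t - q) ψ(q) dq`. -/
def conv (w ψ : L2) (t : T3) : ℂ := ∫ q, w (t - q) * ψ q

theorem norm_conv_le (w ψ : L2) (t : T3) : ‖conv w ψ t‖ ≤ ‖w‖ * ‖ψ‖ := by
  refine (norm_integral_le_integral_norm _).trans ?_
  simp only [norm_mul]
  refine (integral_norm_mul_le (memLp_comp_sub_left w t) (Lp.memLp ψ)).trans_eq ?_
  rw [eLpNorm_comp_sub_left, Lp.norm_def ψ]

theorem stronglyMeasurable_comp_sub (w : L2) :
    StronglyMeasurable (Function.uncurry fun p t : T3 => w (p - t)) :=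
  (Lp.stronglyMeasurable w).comp_measurable (measurable_fst.sub measurable_snd)

theorem stronglyMeasurable_conv (w ψ : L2) : StronglyMeasurable (conv w ψ) :=
  StronglyMeasurable.integral_prod_right (f := fun t q => w (t - q) * ψ q)
    ((stronglyMeasurable_comp_sub w).mul
      ((Lp.stronglyMeasurable ψ).comp_measurable measurable_snd))

/-- The zero-energy solution `E₀⁻¹ (w * ψ)`. -/
def resonanceFun (m : ℝ) (w ψ : L2) (t : T3) : ℂ :=
  conv w ψ t * ((energy m m 0 t)⁻¹ : ℝ)

theorem integrable_resonanceFun {m : ℝ} (hm : 0 < m) (w ψ : L2) :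
    Integrable (resonanceFun m w ψ) :=
  (integrable_inv_energy_zero hm).ofReal.bdd_mul (c := ‖w‖ * ‖ψ‖)
    (stronglyMeasurable_conv w ψ).aestronglyMeasurable (.of_forall fun t => norm_conv_le w ψ t)

/-- Exchanging the integrals over `q` and `t` in `G(0,0) ψ = ψ` exposes `E_0⁻¹ (w * ψ)`. The
exchange needs `w(p - ·) / E_0` integrable, which holds for almost every `p` as both factors are in
`L¹`. -/
theorem ae_eq_integral_resonanceFun {m : ℝ} (hm : 0 < m) {vhat : (Fin 3 → ℤ) → ℝ} {ψ : L2}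
    (hψ : ∀ᵐ p, ∫ q, birmanSchwingerKernel m m vhat 0 0 p q * ψ q = ψ p) :
    ∀ᵐ p, ψ p = (fourierConst : ℂ) ^ 2 *
      ∫ t, sqrtKernel vhat (p - t) * resonanceFun m (sqrtKernel vhat) ψ t := by
  set w := sqrtKernel vhat
  have h1 := ((integrable_inv_energy_zero hm).ofReal (𝕜 := ℂ)).convolution_integrand
    (ContinuousLinearMap.mul ℂ ℂ) (integrable_coeFn w)
  filter_upwards [hψ, h1.prod_right_ae] with p hp hint
  rw [← hp]
  have hint' : Integrable fun t => w (p - t) * (((energy m m 0 t)⁻¹ : ℝ) : ℂ) :=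
    hint.congr (.of_forall fun t => by
      simp only [ContinuousLinearMap.mul_apply']
      exact mul_comm _ _)
  have h2 := integral_mul_integral_mul_swap (Lp.memLp ψ) hint' (B := fun q t => w (t - q))
    ((Lp.stronglyMeasurable w).comp_measurable (measurable_snd.sub measurable_fst))
    (fun t => memLp_comp_sub_left w t) (fun t => (eLpNorm_comp_sub_left w t).le)
  have h3 : ((((2 * Real.pi) ^ 3)⁻¹ : ℝ) : ℂ) = (fourierConst : ℂ) ^ 2 := by
    rw [← fourierConst_sq]
    push_cast
    rfl
  calc ∫ q, birmanSchwingerKernel m m vhat 0 0 p q * ψ q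
      = ∫ q, (fourierConst : ℂ) ^ 2 * (ψ q * ∫ t, w (t - q) *
          (w (p - t) * (((energy m m 0 t)⁻¹ : ℝ) : ℂ))) := by
        refine integral_congr_ae (.of_forall fun q => ?_)
        simp only [birmanSchwingerKernel, sub_zero, h3]
        rw [mul_assoc, mul_comm (∫ t, _) (ψ q)]
        congr 3
        funext t
        exact mul_comm _ _
    _ = _ := by
        rw [integral_const_mul, h2]
        congr 1
        refine integral_congr_ae (.of_forall fun t => ?_)
        simp only [resonanceFun, conv, mul_comm (ψ _)]
        ring

/-- The zero-energy solution satisfies `E₀ f = v * f`. -/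
theorem conv_eq_integral_potentialKernel {m : ℝ} (hm : 0 < m) {vhat : (Fin 3 → ℤ) → ℝ}
    (hs : Summable fun s => |vhat s|) (h0 : ∀ s, 0 ≤ vhat s) {ψ : L2}
    (hψ : ∀ᵐ p, ∫ q, birmanSchwingerKernel m m vhat 0 0 p q * ψ q = ψ p) (t : T3) :
    conv (sqrtKernel vhat) ψ t = (fourierConst : ℂ) *
      ∫ s, potentialKernel vhat (t - s) * resonanceFun m (sqrtKernel vhat) ψ s := by
  have h1 := ae_eq_integral_resonanceFun hm hψ
  set w := sqrtKernel vhat with hw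
  have h2 := integral_mul_integral_mul_swap (memLp_comp_sub_left w t)
    (integrable_resonanceFun hm w ψ) (stronglyMeasurable_comp_sub w)
    (fun s => memLp_comp_sub_right w s) (fun s => (eLpNorm_comp_sub_right w s).le)
  calc conv w ψ t = ∫ p, (fourierConst : ℂ) ^ 2 *
        (w (t - p) * ∫ s, w (p - s) * resonanceFun m w ψ s) := by
        refine integral_congr_ae ?_
        filter_upwards [h1] with p hp
        rw [hp]
        ring
    _ = _ := by
        rw [integral_const_mul, h2, sq, mul_assoc, ← integral_const_mul]
        congr 1
        refine integral_congr_ae (.of_forall fun s => ?_)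
        simp only [← mul_assoc]
        rw [integral_sqrtKernel_mul_sub hs h0]

/-- By the zero-energy equation this is the convolution of the continuous `v` with an integrable
function. Continuity carries nonvanishing at the origin over to a neighbourhood. -/
theorem continuous_conv_sqrtKernel {m : ℝ} (hm : 0 < m) {vhat : (Fin 3 → ℤ) → ℝ}
    (hs : Summable fun s => |vhat s|) (h0 : ∀ s, 0 ≤ vhat s) {ψ : L2}
    (hψ : ∀ᵐ p, ∫ q, birmanSchwingerKernel m m vhat 0 0 p q * ψ q = ψ p) :
    Continuous (conv (sqrtKernel vhat) ψ) := by
  rw [show conv (sqrtKernel vhat) ψ = _ from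
    funext fun t => conv_eq_integral_potentialKernel hm hs h0 hψ t]
  have hf := integrable_resonanceFun hm (sqrtKernel vhat) ψ
  refine continuous_const.mul (continuous_of_dominated
    (bound := fun s => ‖potentialKernel vhat‖ * ‖resonanceFun m (sqrtKernel vhat) ψ s‖)
    (fun t => ?_) (fun t => .of_forall fun s => ?_) (hf.norm.const_mul _)
    (.of_forall fun s => by fun_prop))
  · exact (by fun_prop : Continuous fun s => potentialKernel vhat (t - s)).aestronglyMeasurable.mul
      hf.aestronglyMeasurable
  · rw [norm_mul]
    gcongr
    exact (potentialKernel vhat).norm_coe_le_norm _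

/-- Through this identity the resonance condition says that the numerator of the zero-energy
solution is nonzero at the singularity of `1/E_0`. -/
theorem conv_sqrtKernel_zero {vhat : (Fin 3 → ℤ) → ℝ} (hs : Summable fun s => |vhat s|)
    (heven : ∀ s, vhat (-s) = vhat s) (ψ : L2) :
    conv (sqrtKernel vhat) ψ 0 = ∫ p, sqrtKernel vhat p * ψ p := by
  refine integral_congr_ae ?_
  filter_upwards [sqrtKernel_neg hs heven] with q hq
  rw [zero_sub, hq]

/-- A zero-energy solution whose numerator does not vanish at the origin is not square-integrable. -/
theorem not_memLp_resonanceFun {m : ℝ} (hm : 0 < m) {w ψ : L2} (hcont : Continuous (conv w ψ))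
    (h0 : conv w ψ 0 ≠ 0) : ¬ MemLp (resonanceFun m w ψ) 2 := by
  intro hmem
  have hint := (memLp_two_iff_integrable_sq_norm hmem.aestronglyMeasurable).1 hmem
  set c := ‖conv w ψ 0‖ / 2 with hc
  have hcpos : 0 < c := half_pos (norm_pos_iff.2 h0)
  have h1 : ∀ᶠ q in 𝓝 (0 : T3), c < ‖conv w ψ q‖ :=
    hcont.norm.continuousAt.eventually (lt_mem_nhds (by
      have := norm_pos_iff.2 h0
      rw [hc]; linarith))
  obtain ⟨r, hr, hball⟩ := Metric.nhds_basis_closedBall.eventually_iff.1 h1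
  refine not_integrable_of_le_energy_zero hm (c := c ^ 2) (by positivity) hr
    (.of_forall fun q => by positivity) ?_ hint
  filter_upwards [ae_ne_zero 0] with q hq hqr
  have hE := energy_zero_pos hm hq
  have h2 : c ≤ ‖conv w ψ q‖ := (hball (by simpa using hqr)).le
  rw [resonanceFun, norm_mul, Complex.norm_real, Real.norm_of_nonneg (inv_nonneg.2 hE.le), mul_pow,
    mul_assoc, ← mul_pow, inv_mul_cancel₀ hE.ne', one_pow, mul_one]
  gcongr

/-! ### Regularization and its convergence in `L¹` -/

/-- The zero-energy solution with the energy denominator shifted by `δ`. -/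
def regularized {m : ℝ} (hm : 0 < m) {w ψ : L2} (hcont : Continuous (conv w ψ)) {δ : ℝ}
    (hδ : 0 < δ) : C(T3, ℂ) where
  toFun t := conv w ψ t * ((energy m m 0 t + δ)⁻¹ : ℝ)
  continuous_toFun := hcont.mul <| Complex.continuous_ofReal.comp <|
    ((continuous_energy m m 0).add continuous_const).inv₀ fun t =>
      (add_pos_of_nonneg_of_pos (energy_zero_nonneg hm t) hδ).ne'

/-- `regularized` as an element of `L²(𝕋³)`. -/
def regularizedLp {m : ℝ} (hm : 0 < m) {w ψ : L2} (hcont : Continuous (conv w ψ)) {δ : ℝ}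
    (hδ : 0 < δ) : L2 :=
  ContinuousMap.toLp 2 (volume : Measure T3) ℂ (regularized hm hcont hδ)

theorem regularizedLp_coeFn {m : ℝ} (hm : 0 < m) {w ψ : L2} (hcont : Continuous (conv w ψ))
    {δ : ℝ} (hδ : 0 < δ) :
    regularizedLp hm hcont hδ =ᵐ[volume] fun t => conv w ψ t * ((energy m m 0 t + δ)⁻¹ : ℝ) :=
  ContinuousMap.coeFn_toLp (p := 2) (𝕜 := ℂ) (volume : Measure T3) _

theorem norm_regularized_le {m : ℝ} {w ψ : L2} {δ : ℝ} (hδ : 0 < δ) {t : T3}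
    (ht : 0 < energy m m 0 t) :
    ‖conv w ψ t * (((energy m m 0 t + δ)⁻¹ : ℝ) : ℂ)‖ ≤ ‖resonanceFun m w ψ t‖ := by
  rw [resonanceFun, norm_mul, norm_mul, Complex.norm_real, Complex.norm_real,
    Real.norm_of_nonneg (by positivity), Real.norm_of_nonneg (by positivity)]
  gcongr
  linarith

theorem resonanceFun_sub_regularized {m : ℝ} {w ψ : L2} {δ : ℝ} (hδ : 0 < δ) {t : T3}
    (ht : 0 < energy m m 0 t) :
    resonanceFun m w ψ t - conv w ψ t * (((energy m m 0 t + δ)⁻¹ : ℝ) : ℂ) =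
      resonanceFun m w ψ t * ((δ / (energy m m 0 t + δ) : ℝ) : ℂ) := by
  have h1 : (energy m m 0 t : ℂ) ≠ 0 := by exact_mod_cast ht.ne'
  have h2 : ((energy m m 0 t : ℂ) + δ) ≠ 0 := by exact_mod_cast (add_pos ht hδ).ne'
  rw [resonanceFun]
  push_cast
  field_simp
  ring

theorem norm_resonanceFun_sub_regularized_le {m : ℝ} {w ψ : L2} {δ : ℝ} (hδ : 0 < δ) {t : T3}
    (ht : 0 < energy m m 0 t) :
    ‖resonanceFun m w ψ t - conv w ψ t * (((energy m m 0 t + δ)⁻¹ : ℝ) : ℂ)‖ ≤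
      ‖resonanceFun m w ψ t‖ := by
  rw [resonanceFun_sub_regularized hδ ht, norm_mul, Complex.norm_real,
    Real.norm_of_nonneg (by positivity)]
  exact mul_le_of_le_one_right (norm_nonneg _) ((div_le_one (by positivity)).2 (by linarith))

theorem tendsto_resonanceFun_sub_regularized {m : ℝ} {w ψ : L2} {δ : ℕ → ℝ} (hδ : ∀ n, 0 < δ n)
    (hlim : Tendsto δ atTop (𝓝 0)) {t : T3} (ht : 0 < energy m m 0 t) :
    Tendsto (fun n => resonanceFun m w ψ t -
      conv w ψ t * (((energy m m 0 t + δ n)⁻¹ : ℝ) : ℂ)) atTop (𝓝 0) := by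
  simp only [fun n => resonanceFun_sub_regularized (w := w) (ψ := ψ) (hδ n) ht]
  have h1 : Tendsto (fun n => δ n / (energy m m 0 t + δ n)) atTop (𝓝 0) := by
    have h : Tendsto (fun n => δ n / (energy m m 0 t + δ n)) atTop
        (𝓝 (0 / (energy m m 0 t + 0))) :=
      hlim.div (hlim.const_add (energy m m 0 t)) (by rw [add_zero]; exact ht.ne')
    rwa [zero_div] at h
  have h2 := ((Complex.continuous_ofReal.tendsto 0).comp h1).const_mul (resonanceFun m w ψ t)
  simpa using h2

theorem aestronglyMeasurable_sub_regularized {m : ℝ} (hm : 0 < m) {w ψ : L2}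
    (hcont : Continuous (conv w ψ)) {δ : ℝ} (hδ : 0 < δ) :
    AEStronglyMeasurable (fun t => resonanceFun m w ψ t -
      conv w ψ t * (((energy m m 0 t + δ)⁻¹ : ℝ) : ℂ)) volume :=
  (integrable_resonanceFun hm w ψ).aestronglyMeasurable.sub
    (regularized hm hcont hδ).continuous.aestronglyMeasurable

theorem integrable_sub_regularized {m : ℝ} (hm : 0 < m) {w ψ : L2}
    (hcont : Continuous (conv w ψ)) {δ : ℝ} (hδ : 0 < δ) :
    Integrable fun t => resonanceFun m w ψ t -
      conv w ψ t * (((energy m m 0 t + δ)⁻¹ : ℝ) : ℂ) := by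
  refine (integrable_resonanceFun hm w ψ).norm.mono'
    (aestronglyMeasurable_sub_regularized hm hcont hδ) ?_
  filter_upwards [ae_ne_zero 0] with t ht
  exact norm_resonanceFun_sub_regularized_le hδ (energy_zero_pos hm ht)

theorem tendsto_integral_norm_sub_regularized {m : ℝ} (hm : 0 < m) {w ψ : L2}
    (hcont : Continuous (conv w ψ)) {δ : ℕ → ℝ} (hδ : ∀ n, 0 < δ n)
    (hlim : Tendsto δ atTop (𝓝 0)) :
    Tendsto (fun n => ∫ t, ‖resonanceFun m w ψ t -
      conv w ψ t * (((energy m m 0 t + δ n)⁻¹ : ℝ) : ℂ)‖) atTop (𝓝 0) := by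
  have h := tendsto_integral_of_dominated_convergence (μ := (volume : Measure T3))
    (F := fun n t => ‖resonanceFun m w ψ t -
      conv w ψ t * (((energy m m 0 t + δ n)⁻¹ : ℝ) : ℂ)‖) (f := fun _ => 0)
    (fun t => ‖resonanceFun m w ψ t‖)
    (fun n => (aestronglyMeasurable_sub_regularized hm hcont (hδ n)).norm)
    (integrable_resonanceFun hm w ψ).norm
    (fun n => by
      filter_upwards [ae_ne_zero 0] with t ht
      rw [norm_norm]
      exact norm_resonanceFun_sub_regularized_le (hδ n) (energy_zero_pos hm ht))
    (by
      filter_upwards [ae_ne_zero 0] with t ht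
      have := (tendsto_resonanceFun_sub_regularized (w := w) (ψ := ψ) hδ hlim
        (energy_zero_pos hm ht)).norm
      rwa [norm_zero] at this)
  simpa using h

/-! ### The regularized resonance function as a trial state -/

theorem norm_potential_integral_le {vhat : (Fin 3 → ℤ) → ℝ} {g : T3 → ℂ} (hg : Integrable g)
    (t : T3) : ‖(fourierConst : ℂ) * ∫ s, potentialKernel vhat (t - s) * g s‖ ≤
      fourierConst * (‖potentialKernel vhat‖ * ∫ s, ‖g s‖) := by
  rw [norm_mul, Complex.norm_real, Real.norm_of_nonneg fourierConst_pos.le]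
  refine mul_le_mul_of_nonneg_left ?_ fourierConst_pos.le
  rw [← integral_const_mul]
  refine norm_integral_le_of_norm_le (hg.norm.const_mul _) (.of_forall fun s => ?_)
  rw [norm_mul]
  gcongr
  exact (potentialKernel vhat).norm_coe_le_norm _

/-- Since `(E_0 + δ) u = w * ψ`, which is `v * f` up to normalization, `(H(0) + δ) u` is the
convolution of `v` with `f - u`. Its supremum is controlled by `‖v‖_∞ ‖f - u‖₁`; pair this with `|u|
≤ |f|` and drop `δ‖u‖² ≥ 0`. -/
theorem re_inner_hamiltonian_regularizedLp_le {m : ℝ} (hm : 0 < m) {vhat : (Fin 3 → ℤ) → ℝ}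
    (hs : Summable fun s => |vhat s|) (h0 : ∀ s, 0 ≤ vhat s) {ψ : L2}
    (hψ : ∀ᵐ p, ∫ q, birmanSchwingerKernel m m vhat 0 0 p q * ψ q = ψ p)
    (hcont : Continuous (conv (sqrtKernel vhat) ψ)) {δ : ℝ} (hδ : 0 < δ) :
    (inner ℂ (hamiltonian m m vhat 0 (regularizedLp hm hcont hδ))
      (regularizedLp hm hcont hδ)).re ≤
      fourierConst * (‖potentialKernel vhat‖ *
        ∫ t, ‖resonanceFun m (sqrtKernel vhat) ψ t -
          conv (sqrtKernel vhat) ψ t * (((energy m m 0 t + δ)⁻¹ : ℝ) : ℂ)‖) *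
      ∫ t, ‖resonanceFun m (sqrtKernel vhat) ψ t‖ := by
  set w := sqrtKernel vhat with hw
  set u := regularizedLp hm hcont hδ with hu
  set R := fourierConst * (‖potentialKernel vhat‖ *
    ∫ t, ‖resonanceFun m w ψ t - conv w ψ t * (((energy m m 0 t + δ)⁻¹ : ℝ) : ℂ)‖) with hR
  have hR0 : 0 ≤ R := mul_nonneg fourierConst_pos.le
    (mul_nonneg (norm_nonneg _) (integral_nonneg fun t => norm_nonneg _))
  have hucoe := regularizedLp_coeFn hm hcont hδ
  have hdiff : hamiltonian m m vhat 0 u + (δ : ℂ) • u =ᵐ[volume] fun t =>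
      (fourierConst : ℂ) * ∫ s, potentialKernel vhat (t - s) * (resonanceFun m w ψ s -
        conv w ψ s * (((energy m m 0 s + δ)⁻¹ : ℝ) : ℂ)) := by
    rw [hamiltonian, sub_apply]
    filter_upwards [Lp.coeFn_add (freeOp m m 0 u - interaction vhat u) ((δ : ℂ) • u),
      Lp.coeFn_sub (freeOp m m 0 u) (interaction vhat u), Lp.coeFn_smul (δ : ℂ) u,
      freeOp_coeFn m m 0 u, convOp_coeFn (potentialKernel vhat) u, hucoe] with t h1 h2 h3 h4 h5 h6
    rw [h1, Pi.add_apply, h2, Pi.sub_apply, h3, Pi.smul_apply, h4, interaction, h5, h6]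
    have hpos : (energy m m 0 t : ℂ) + δ ≠ 0 := by
      exact_mod_cast (add_pos_of_nonneg_of_pos (energy_zero_nonneg hm t) hδ).ne'
    have h7 : (energy m m 0 t : ℂ) * (conv w ψ t * (((energy m m 0 t + δ)⁻¹ : ℝ) : ℂ)) +
        (δ : ℂ) • (conv w ψ t * (((energy m m 0 t + δ)⁻¹ : ℝ) : ℂ)) = conv w ψ t := by
      push_cast
      rw [smul_eq_mul]
      field_simp
    have h8 : ∫ s, potentialKernel vhat (t - s) * u s = ∫ s, potentialKernel vhat (t - s) *
        (conv w ψ s * (((energy m m 0 s + δ)⁻¹ : ℝ) : ℂ)) := by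
      refine integral_congr_ae ?_
      filter_upwards [hucoe] with s hs
      rw [hs]
    have hbdd : ∀ g : T3 → ℂ, Integrable g → Integrable fun s => potentialKernel vhat (t - s) * g s :=
      fun g hg => hg.bdd_mul (c := ‖potentialKernel vhat‖)
        (by fun_prop : Continuous fun s => potentialKernel vhat (t - s)).aestronglyMeasurable
        (.of_forall fun s => (potentialKernel vhat).norm_coe_le_norm _)
    have hint1 := hbdd _ (integrable_resonanceFun hm w ψ)
    have hint2 : Integrable fun s => potentialKernel vhat (t - s) *
        (conv w ψ s * (((energy m m 0 s + δ)⁻¹ : ℝ) : ℂ)) :=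
      hbdd _ ((integrable_coeFn u).congr hucoe)
    simp only [mul_sub]
    rw [integral_sub hint1 hint2, mul_sub,
      ← conv_eq_integral_potentialKernel hm hs h0 hψ, ← hw, h8]
    linear_combination h7
  have h1 : (inner ℂ (hamiltonian m m vhat 0 u) u).re ≤
      (inner ℂ (hamiltonian m m vhat 0 u + (δ : ℂ) • u) u).re := by
    rw [inner_add_left, inner_smul_left, Complex.conj_ofReal, inner_self_eq_integral,
      ← Complex.ofReal_mul, Complex.add_re, Complex.ofReal_re]
    have : 0 ≤ ∫ q, ‖u q‖ ^ 2 := integral_nonneg fun q => by positivity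
    nlinarith
  refine h1.trans ((Complex.re_le_norm _).trans ?_)
  rw [L2.inner_def, ← integral_const_mul]
  refine norm_integral_le_of_norm_le ((integrable_resonanceFun hm w ψ).norm.const_mul _) ?_
  filter_upwards [hdiff, hucoe, ae_ne_zero 0] with t h2 h3 h4
  refine (norm_inner_le_norm _ _).trans ?_
  rw [h2, h3]
  exact mul_le_mul (norm_potential_integral_le (integrable_sub_regularized hm hcont hδ) t)
    (norm_regularized_le hδ (energy_zero_pos hm h4)) (norm_nonneg _) hR0

/-! ### The norm weighted by the gap -/

/-- Multiplication by the square root of `energyGap`. -/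
def sqrtGapOp (m : ℝ) (k : Fin 3 → ℝ) : L2 →L[ℂ] L2 :=
  mulOp ⟨fun q => (Real.sqrt (energyGap m k q) : ℂ),
    Complex.continuous_ofReal.comp (continuous_energyGap m k).sqrt⟩

theorem sqrtGapOp_coeFn (m : ℝ) (k : Fin 3 → ℝ) (f : L2) :
    sqrtGapOp m k f =ᵐ[volume] fun q => (Real.sqrt (energyGap m k q) : ℂ) * f q :=
  mulOp_coeFn _ f

theorem norm_sq_sqrt_mul {m : ℝ} (hm : 0 < m) (k : Fin 3 → ℝ) (q : T3) (z : ℂ) :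
    ‖(Real.sqrt (energyGap m k q) : ℂ) * z‖ ^ 2 = energyGap m k q * ‖z‖ ^ 2 := by
  rw [norm_mul, Complex.norm_real, Real.norm_of_nonneg (Real.sqrt_nonneg _), mul_pow,
    Real.sq_sqrt (energyGap_nonneg hm k q)]

theorem norm_sq_sqrtGapOp {m : ℝ} (hm : 0 < m) (k : Fin 3 → ℝ) (f : L2) :
    ‖sqrtGapOp m k f‖ ^ 2 = ∫ q, energyGap m k q * ‖f q‖ ^ 2 := by
  rw [norm_sq_eq_integral]
  refine integral_congr_ae ?_
  filter_upwards [sqrtGapOp_coeFn m k f] with q hq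
  rw [hq, norm_sq_sqrt_mul hm]

theorem eq_zero_of_sqrtGapOp_eq_zero {m : ℝ} (hm : 0 < m) {k : Fin 3 → ℝ}
    (hk : ∀ j, k j ∈ Set.Ioo (-Real.pi) Real.pi) (hk0 : k ≠ 0) {f : L2}
    (hf : sqrtGapOp m k f = 0) : f = 0 := by
  rw [Lp.eq_zero_iff_ae_eq_zero] at hf ⊢
  filter_upwards [hf, sqrtGapOp_coeFn m k f, ae_energyGap_pos hm hk hk0] with q h1 h2 h3
  rw [h2, Pi.zero_apply, mul_eq_zero] at h1
  refine h1.resolve_left ?_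
  exact_mod_cast (Real.sqrt_pos.2 h3).ne'

/-- The bound `D ≤ E_0` cancels one power of the denominator, leaving a multiple of the integrable
`1/E_0`. -/
theorem integrable_energyGap_mul_resonanceFun {m : ℝ} (hm : 0 < m) {k : Fin 3 → ℝ}
    (hk : ∀ j, k j ∈ Set.Ioo (-Real.pi) Real.pi) (w ψ : L2) :
    Integrable fun q => energyGap m k q * ‖resonanceFun m w ψ q‖ ^ 2 := by
  have hmeas := (integrable_resonanceFun hm w ψ).aestronglyMeasurable
  refine ((integrable_inv_energy_zero hm).const_mul ((‖w‖ * ‖ψ‖) ^ 2)).mono'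
    ((continuous_energyGap m k).aestronglyMeasurable.mul (hmeas.norm.pow 2)) ?_
  filter_upwards [ae_ne_zero 0] with q hq
  have hE := energy_zero_pos hm hq
  have hD := energyGap_nonneg hm k q
  rw [Real.norm_of_nonneg (by positivity), resonanceFun, norm_mul, Complex.norm_real,
    Real.norm_of_nonneg (by positivity)]
  calc energyGap m k q * (‖conv w ψ q‖ * (energy m m 0 q)⁻¹) ^ 2
      ≤ energy m m 0 q * ((‖w‖ * ‖ψ‖) * (energy m m 0 q)⁻¹) ^ 2 := by
        gcongr
        · exact energyGap_le hm hk q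
        · exact norm_conv_le w ψ q
    _ = _ := by field_simp

theorem memLp_sqrt_mul_resonanceFun {m : ℝ} (hm : 0 < m) {k : Fin 3 → ℝ}
    (hk : ∀ j, k j ∈ Set.Ioo (-Real.pi) Real.pi) (w ψ : L2) :
    MemLp (fun q => (Real.sqrt (energyGap m k q) : ℂ) * resonanceFun m w ψ q) 2 := by
  have hmeas : AEStronglyMeasurable
      (fun q => (Real.sqrt (energyGap m k q) : ℂ) * resonanceFun m w ψ q) volume :=
    (Complex.continuous_ofReal.comp (continuous_energyGap m k).sqrt).aestronglyMeasurable.mul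
      (integrable_resonanceFun hm w ψ).aestronglyMeasurable
  refine (memLp_two_iff_integrable_sq_norm hmeas).2 ?_
  simp only [norm_sq_sqrt_mul hm]
  exact integrable_energyGap_mul_resonanceFun hm hk w ψ

/-- The zero-energy solution weighted by the square root of `energyGap`, which is
square-integrable. -/
def weightedResonance {m : ℝ} (hm : 0 < m) {k : Fin 3 → ℝ}
    (hk : ∀ j, k j ∈ Set.Ioo (-Real.pi) Real.pi) (w ψ : L2) : L2 :=
  (memLp_sqrt_mul_resonanceFun hm hk w ψ).toLp _

/-- Dividing by `√D`, positive almost everywhere, would make the zero-energy solution equal to `g`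
and hence square-integrable. -/
theorem weightedResonance_ne {m : ℝ} (hm : 0 < m) {k : Fin 3 → ℝ}
    (hk : ∀ j, k j ∈ Set.Ioo (-Real.pi) Real.pi) (hk0 : k ≠ 0) {w ψ : L2}
    (hcont : Continuous (conv w ψ)) (h0 : conv w ψ 0 ≠ 0) (g : L2) :
    sqrtGapOp m k g ≠ weightedResonance hm hk w ψ := by
  intro h
  have h1 : sqrtGapOp m k g =ᵐ[volume]
      fun q => (Real.sqrt (energyGap m k q) : ℂ) * resonanceFun m w ψ q := by
    rw [h]
    exact (memLp_sqrt_mul_resonanceFun hm hk w ψ).coeFn_toLp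
  refine not_memLp_resonanceFun hm hcont h0 ((Lp.memLp g).ae_eq ?_)
  filter_upwards [h1, sqrtGapOp_coeFn m k g, ae_energyGap_pos hm hk hk0] with q h2 h3 h4
  rw [h3] at h2
  refine mul_left_cancel₀ ?_ h2
  exact_mod_cast (Real.sqrt_pos.2 h4).ne'

theorem tendsto_sqrtGapOp_regularizedLp {m : ℝ} (hm : 0 < m) {k : Fin 3 → ℝ}
    (hk : ∀ j, k j ∈ Set.Ioo (-Real.pi) Real.pi) {w ψ : L2} (hcont : Continuous (conv w ψ))
    {δ : ℕ → ℝ} (hδ : ∀ n, 0 < δ n) (hlim : Tendsto δ atTop (𝓝 0)) :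
    Tendsto (fun n => ‖weightedResonance hm hk w ψ -
      sqrtGapOp m k (regularizedLp hm hcont (hδ n))‖ ^ 2) atTop (𝓝 0) := by
  have h1 : ∀ n, ‖weightedResonance hm hk w ψ -
      sqrtGapOp m k (regularizedLp hm hcont (hδ n))‖ ^ 2 =
      ∫ t, energyGap m k t * ‖resonanceFun m w ψ t -
        conv w ψ t * (((energy m m 0 t + δ n)⁻¹ : ℝ) : ℂ)‖ ^ 2 := fun n => by
    rw [norm_sq_eq_integral]
    refine integral_congr_ae ?_
    filter_upwards [Lp.coeFn_sub (weightedResonance hm hk w ψ)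
        (sqrtGapOp m k (regularizedLp hm hcont (hδ n))),
      (memLp_sqrt_mul_resonanceFun hm hk w ψ).coeFn_toLp,
      sqrtGapOp_coeFn m k (regularizedLp hm hcont (hδ n)),
      regularizedLp_coeFn hm hcont (hδ n)] with t h1 h2 h3 h4
    rw [h1, Pi.sub_apply, h3, h4, weightedResonance, h2, ← mul_sub, norm_sq_sqrt_mul hm]
  simp only [h1]
  have h := tendsto_integral_of_dominated_convergence (μ := (volume : Measure T3))
    (F := fun n t => energyGap m k t * ‖resonanceFun m w ψ t -
      conv w ψ t * (((energy m m 0 t + δ n)⁻¹ : ℝ) : ℂ)‖ ^ 2) (f := fun _ => 0)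
    (fun t => energyGap m k t * ‖resonanceFun m w ψ t‖ ^ 2)
    (fun n => (continuous_energyGap m k).aestronglyMeasurable.mul
      ((aestronglyMeasurable_sub_regularized hm hcont (hδ n)).norm.pow 2))
    (integrable_energyGap_mul_resonanceFun hm hk w ψ)
    (fun n => by
      filter_upwards [ae_ne_zero 0] with t ht
      have hD := energyGap_nonneg hm k t
      rw [Real.norm_of_nonneg (by positivity)]
      gcongr
      exact norm_resonanceFun_sub_regularized_le (hδ n) (energy_zero_pos hm ht))
    (by
      filter_upwards [ae_ne_zero 0] with t ht
      have := ((tendsto_resonanceFun_sub_regularized (w := w) (ψ := ψ) hδ hlim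
        (energy_zero_pos hm ht)).norm.pow 2).const_mul (energyGap m k t)
      simpa using this)
  simpa using h

/-- If a trial state has small `H(0)`-energy compared with its distance to `ker H(0)` in the norm
weighted by `energyGap`, then the form of `H(k) - E_min(k)` is negative on the span of `ker H(0)`
and the trial state. -/
theorem form_neg_of_trial {m : ℝ} (hm : 0 < m) {vhat : (Fin 3 → ℤ) → ℝ}
    (hH : (hamiltonian m m vhat 0).IsPositive) {k : Fin 3 → ℝ}
    (hk : ∀ j, k j ∈ Set.Ioo (-Real.pi) Real.pi) (hk0 : k ≠ 0) {u : L2} {d : ℝ}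
    (hu : (inner ℂ (hamiltonian m m vhat 0 u) u).re < d ^ 2) (hd0 : 0 ≤ d)
    (hd : ∀ g : L2, hamiltonian m m vhat 0 g = 0 → d ≤ ‖sqrtGapOp m k (u + g)‖) (g : L2)
    (hg : hamiltonian m m vhat 0 g = 0) (a : ℂ) (hga : g ≠ 0 ∨ a ≠ 0) :
    (inner ℂ ((shiftedFreeOp m k - interaction vhat) (g + a • u)) (g + a • u)).re < 0 := by
  have h1 : inner ℂ (hamiltonian m m vhat 0 (g + a • u)) (g + a • u) =
      ((‖a‖ ^ 2 : ℝ) : ℂ) * inner ℂ (hamiltonian m m vhat 0 u) u := by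
    -- Cross terms vanish because `g` is in the kernel of a symmetric operator, so only `|a|²` times
    -- the energy of `u` survives.
    have h2 : inner ℂ (hamiltonian m m vhat 0 u) g = 0 := by
      have h3 := hH.isSymmetric u g
      simp only [ContinuousLinearMap.coe_coe] at h3
      rw [h3, hg, inner_zero_right]
    rw [map_add, hg, zero_add, map_smul, inner_smul_left, inner_add_right, h2, zero_add,
      inner_smul_right, ← mul_assoc, Complex.conj_mul']
    push_cast
    rfl
  rw [re_inner_shifted hm hk, h1, Complex.re_ofReal_mul, ← norm_sq_sqrtGapOp hm, sub_neg]
  by_cases ha : a = 0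
  · subst ha
    have hg0 : g ≠ 0 := hga.resolve_right fun h => h rfl
    have h2 : sqrtGapOp m k g ≠ 0 := fun h => hg0 (eq_zero_of_sqrtGapOp_eq_zero hm hk hk0 h)
    have h3 := norm_pos_iff.2 h2
    rw [zero_smul, add_zero, norm_zero]
    norm_num
    positivity
  · have h2 : g + a • u = a • (u + a⁻¹ • g) := by
      rw [smul_add, smul_inv_smul₀ ha, add_comm]
    have h3 := hd (a⁻¹ • g) (by rw [map_smul, hg, smul_zero])
    have ha' := norm_pos_iff.2 ha
    rw [h2, map_smul, norm_smul, mul_pow]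
    refine mul_lt_mul_of_pos_left (hu.trans_le ?_) (by positivity)
    gcongr

/-- A zero-energy resonance provides trial states as required by `form_neg_of_trial`. -/
theorem exists_trial {m : ℝ} (hm : 0 < m) {vhat : (Fin 3 → ℤ) → ℝ}
    (heven : ∀ s, vhat (-s) = vhat s) (hs : Summable fun s => |vhat s|)
    (h0 : ∀ s, 0 ≤ vhat s) (hres : HasZeroEnergyResonance m m vhat)
    (hfin : FiniteDimensional ℂ (hamiltonian m m vhat 0).ker)
    {k : Fin 3 → ℝ} (hk : ∀ j, k j ∈ Set.Ioo (-Real.pi) Real.pi) (hk0 : k ≠ 0) :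
    ∃ (u : L2) (d : ℝ), 0 ≤ d ∧ (inner ℂ (hamiltonian m m vhat 0 u) u).re < d ^ 2 ∧
      ∀ g : L2, hamiltonian m m vhat 0 g = 0 → d ≤ ‖sqrtGapOp m k (u + g)‖ := by
  obtain ⟨ψ, hψ, hne⟩ := hres
  have hcont := continuous_conv_sqrtKernel hm hs h0 hψ
  rw [← conv_sqrtKernel_zero hs heven] at hne
  set w := sqrtKernel vhat with hw
  set F := weightedResonance hm hk w ψ with hF
  set K := (hamiltonian m m vhat 0).ker with hK
  set L : Submodule ℂ L2 := K.map (sqrtGapOp m k : L2 →ₗ[ℂ] L2) with hL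
  -- Finite multiplicity enters here: a finite-dimensional image is closed, so lying outside it
  -- means positive distance.
  have hclosed : IsClosed (L : Set L2) := L.closed_of_finiteDimensional
  have hFL : F ∉ (L : Set L2) := by
    rintro ⟨g, -, hg⟩
    exact weightedResonance_ne hm hk hk0 hcont hne g hg
  have hdist := (hclosed.notMem_iff_infDist_pos ⟨0, L.zero_mem⟩).1 hFL
  set e := Metric.infDist F (L : Set L2) with he
  have hFg : ∀ g : L2, hamiltonian m m vhat 0 g = 0 → e ≤ ‖F + sqrtGapOp m k g‖ := fun g hg => by
    have hmem : sqrtGapOp m k (-g) ∈ (L : Set L2) :=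
      ⟨-g, by simp [hK, hg], rfl⟩
    have := Metric.infDist_le_dist_of_mem (x := F) hmem
    rwa [dist_eq_norm, map_neg, sub_neg_eq_add] at this
  have hδ : ∀ n : ℕ, (0 : ℝ) < 1 / ((n : ℝ) + 1) := fun n => Nat.one_div_pos_of_nat
  have hlim : Tendsto (fun n : ℕ => (1 : ℝ) / ((n : ℝ) + 1)) atTop (𝓝 0) :=
    tendsto_one_div_add_atTop_nhds_zero_nat
  have h1 := tendsto_sqrtGapOp_regularizedLp hm hk hcont hδ hlim
  have h2 := (((tendsto_integral_norm_sub_regularized hm hcont hδ hlim).const_mul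
    ‖potentialKernel vhat‖).const_mul fourierConst).mul_const
      (∫ t, ‖resonanceFun m w ψ t‖)
  simp only [mul_zero, zero_mul] at h2
  -- Half of the distance `e` is spent on replacing `F` by its regularization; the other half
  -- remains as `d`.
  have hpos : 0 < (e / 2) ^ 2 := by positivity
  obtain ⟨n, hn1, hn2⟩ := ((h1.eventually (gt_mem_nhds hpos)).and
    (h2.eventually (gt_mem_nhds hpos))).exists
  refine ⟨regularizedLp hm hcont (hδ n), e / 2, by positivity,
    (re_inner_hamiltonian_regularizedLp_le hm hs h0 hψ hcont (hδ n)).trans_lt hn2, fun g hg => ?_⟩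
  have h3 : ‖F - sqrtGapOp m k (regularizedLp hm hcont (hδ n))‖ < e / 2 :=
    lt_of_pow_lt_pow_left₀ 2 (by positivity) hn1
  have h4 := hFg g hg
  have h5 : F + sqrtGapOp m k g = (F - sqrtGapOp m k (regularizedLp hm hcont (hδ n))) +
      sqrtGapOp m k (regularizedLp hm hcont (hδ n) + g) := by
    rw [map_add]
    abel
  have h6 := norm_add_le (F - sqrtGapOp m k (regularizedLp hm hcont (hδ n)))
    (sqrtGapOp m k (regularizedLp hm hcont (hδ n) + g))
  rw [← h5] at h6
  linarith

end

end LatticeSchrodinger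

/-! ### The theorem -/

open LatticeSchrodinger
theorem theorem6p6
    (m : ℝ) (hm : 0 < m)
    (vhat : (Fin 3 → ℤ) → ℝ) (heven : ∀ s, vhat (-s) = vhat s)
    (κ : ℝ) (hκ : 1 / 2 < κ)
    (hdecay : Tendsto (fun s => Real.sqrt (∑ j, (s j : ℝ) ^ 2) ^ (3 + κ) * vhat s) cofinite (𝓝 0))
    (hV : (interaction vhat).IsPositive)
    (hH : (hamiltonian m m vhat 0).IsPositive)
    (n : ℕ) (hn : Module.rank ℂ (Module.End.eigenspace (hamiltonian m m vhat 0).toLinearMap 0) = n)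
    (hres : HasZeroEnergyResonance m m vhat)
    (k : Fin 3 → ℝ) (hk : ∀ j, k j ∈ Set.Ioo (-Real.pi) Real.pi) (hk0 : k ≠ 0) :
    ∃ (μ : Fin (n + 1) → ℝ) (f : Fin (n + 1) → L2), Orthonormal ℂ f ∧
      ∀ i, hamiltonian m m vhat k (f i) = (μ i : ℂ) • f i ∧
        0 ≤ μ i ∧ μ i < energyMin m m k := by
  have hs := summable_abs_of_decay (by linarith) hdecay
  rw [Module.End.eigenspace_zero] at hn
  have hfin : FiniteDimensional ℂ (hamiltonian m m vhat 0).ker :=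
    Module.rank_lt_aleph0_iff.1 (hn.trans_lt (Cardinal.natCast_lt_aleph0))
  have hrank : Module.finrank ℂ (hamiltonian m m vhat 0).ker = n :=
    Module.finrank_eq_of_rank_eq hn
  obtain ⟨u, d, hd0, hu, hd⟩ := exists_trial hm heven hs (vhat_nonneg hs hV) hres hfin hk hk0
  -- The abstract product has dimension `n + 1` at once; independence of `u` from the kernel need
  -- not be checked separately.
  let T : (hamiltonian m m vhat 0).ker × ℂ →ₗ[ℂ] L2 :=
    (hamiltonian m m vhat 0).ker.subtype.coprod (LinearMap.toSpanSingleton ℂ L2 u)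
  refine exists_eigenvalues_of_form_neg hs hV hH T (fun x hx => ?_) (by
    rw [Module.finrank_prod, hrank, Module.finrank_self])
  have hx' : (x.1 : L2) ≠ 0 ∨ x.2 ≠ 0 := by
    by_contra! h
    exact hx (Prod.ext (Subtype.ext h.1) h.2)
  have hT : T x = (x.1 : L2) + x.2 • u := rfl
  rw [hT]
  exact form_neg_of_trial hm hH hk hk0 hu hd0 hd x.1 x.1.2 x.2 hx'
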